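/- Let $a<b$ be real, let $n\ge 1$ be an integer, let $x_k=a+k\,\frac{b-a}{n}$ for $k=0,\dots,n$, and put $J_k=(x_{k-1},x_k)$ for $k=1,\dots,n$. Let $S^n_{5,1}$ be the space of all $f\in C^1[a,b]$ whose restriction to each $J_k$ is a polynomial of degree at most $5$. A quadrature rule $Q(f)=\sum_{i=1}^m\omega_i f(\tau_i)$ with distinct nodes $\tau_i\in[a,b]$ and real weights $\omega_i$ is called exact if $Q(f)=\int_a^b f(t)\,dt$ for every $f\in S^n_{5,1}$, and Gaussian if it is exact and no exact rule has fewer nodes. Gaussian rules exist, and every Gaussian rule has exactly $2n+1$ nodes, placed as follows. If $n$ is even, each $J_k$ $(k=1,\dots,n)$ contains exactly two nodes, and the midpoint $x_{n/2}=(a+b)/2$ of $[a,b]$ is also a node. If $n$ is odd, each $J_k$ with $1\le k\le n$ and $k\neq (n+1)/2$ contains exactly two nodes, while $J_{(n+1)/2}$ contains exactly three nodes: the midpoint $(a+b)/2$ and two others positioned symmetrically with respect to it. -/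

import Mathlib

/-- The `k`-th knot `x_k = a + k (b - a) / n` of the uniform partition of `[a, b]` into `n`
subintervals. -/
noncomputable def knot (a b : ℝ) (n k : ℕ) : ℝ :=
  a + (k : ℝ) * ((b - a) / (n : ℝ))

/-- The open subinterval `J_k = (x_{k-1}, x_k)`; it is used for `1 ≤ k ≤ n` only. -/
def subinterval (a b : ℝ) (n k : ℕ) : Set ℝ :=
  Set.Ioo (knot a b n (k - 1)) (knot a b n k)

/-- `f` (restricted to `[a, b]`) is a `C¹` quintic spline: it is continuously differentiable on
`[a, b]` (one-sidedly at the ends) and agrees on each open subinterval `J_k` with a polynomial of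
degree at most five. -/
def IsC1QuinticSpline (a b : ℝ) (n : ℕ) (f : ℝ → ℝ) : Prop :=
  ContDiffOn ℝ 1 f (Set.Icc a b) ∧
    ∀ k : ℕ, 1 ≤ k → k ≤ n →
      ∃ p : Polynomial ℝ, p.natDegree ≤ 5 ∧ ∀ t ∈ subinterval a b n k, f t = p.eval t

/-- A quadrature rule on `[a, b]`: finitely many distinct nodes in `[a, b]`, each with a real
weight of arbitrary sign (the values of `weight` off the nodes play no role). -/
structure QuadratureRule (a b : ℝ) where
  nodes : Finset ℝ
  weight : ℝ → ℝ
  nodes_subset : (nodes : Set ℝ) ⊆ Set.Icc a b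

/-- The value `∑ ωᵢ f(τᵢ)` of the rule at `f`. -/
def QuadratureRule.apply {a b : ℝ} (Q : QuadratureRule a b) (f : ℝ → ℝ) : ℝ :=
  ∑ t ∈ Q.nodes, Q.weight t * f t

/-- The rule integrates every `C¹` quintic spline exactly. -/
def QuadratureRule.IsExact {a b : ℝ} (n : ℕ) (Q : QuadratureRule a b) : Prop :=
  ∀ f : ℝ → ℝ, IsC1QuinticSpline a b n f → ∫ t in a..b, f t = Q.apply f

/-- A Gaussian (optimal) rule: it is exact, and no exact rule has fewer nodes. -/
def QuadratureRule.IsGaussian {a b : ℝ} (n : ℕ) (Q : QuadratureRule a b) : Prop :=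
  Q.IsExact n ∧ ∀ Q' : QuadratureRule a b, Q'.IsExact n → Q.nodes.card ≤ Q'.nodes.card

/-! Existence. On quintics, `A g(0) + B g'(0) + ∫₀¹ g` equals a combination of two interior values
plus a functional `A' g(1) + B' g'(1)`, which the next element takes over (`exists_twoPoint_unit`).
This is two-point Gauss quadrature with weight `(1 - t)²`, a factor that kills value and slope at
`1`. Started at `(0, 0)`, the recursion stays in the region `AdmissibleState`. The right half of the
rule is the mirror image of the left. Reflection negates `A` and keeps `B`, so at a middle knot the
slope terms cancel and a point mass remains; for odd `n` the middle element carries a symmetric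
functional and takes a three-point rule (`exists_threePoint_unit`). Both cases give `2n + 1` nodes.

Uniqueness. Let `D` be the difference between an exact rule with at most `2n + 1` nodes and the rule
just built. The kernel `K(t) = D((· - t)₊)` is piecewise linear and breaks only at atoms of `D`.
Truncated powers of degrees 2 to 5 based at knots are splines, so four successive primitives of `K`
(up to constants) vanish at every knot. By Rolle, `K` alternates in sign at five points of each
element on which it is not identically zero (`peanoKernel_alternates`). An element where `K`
vanishes contains no atom, so the nodes of the constructed rule there belong to both rules and count
twice. If `K ≠ 0`, the count reaches `4n + 3`, more than the `2(2n + 1)` available; hence `D = 0`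
(`eq_zero_of_annihilates`). Minimality and the node positions follow. -/

/-! ### The recursion on states and the two-point rule on the unit element. -/

/-- The set of states `(A, B)` reached by the two-point recursion. -/
structure AdmissibleState (A B : ℝ) : Prop where
  lower : -(1 / 60) < B
  upper : B ≤ 0
  le_left : A ≤ 7 / 30
  le_right : 7 / 30 - A ≤ 14 * (B + 1 / 60)

lemma admissibleState_zero : AdmissibleState 0 0 := by
  constructor <;> norm_num

/-- The quintic with coefficients `c₀, …, c₅` at `t`. -/
def quinticValue (c : ℕ → ℝ) (t : ℝ) : ℝ :=
  c 0 + c 1 * t + c 2 * t ^ 2 + c 3 * t ^ 3 + c 4 * t ^ 4 + c 5 * t ^ 5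

/-- The derivative of the quintic with coefficients `c₀, …, c₅` at `t`. -/
def quinticSlope (c : ℕ → ℝ) (t : ℝ) : ℝ :=
  c 1 + 2 * c 2 * t + 3 * c 3 * t ^ 2 + 4 * c 4 * t ^ 3 + 5 * c 5 * t ^ 4

/-- The integral over `[0, 1]` of the quintic with coefficients `c₀, …, c₅`. -/
noncomputable def quinticIntegral (c : ℕ → ℝ) : ℝ :=
  c 0 + c 1 / 2 + c 2 / 3 + c 3 / 4 + c 4 / 5 + c 5 / 6

/-- The variables `u = 7/30 - A` and `v = B + 1/60` measure the distance to the fixed point of the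
recursion, which comes from the quintic-exact formula `∫₀¹ g = 7/30 (g(0) + g(1)) + 8/15 g(1/2) +
(g'(0) - g'(1))/60`. The factor `E` stays away from zero, so `v' = B' + 1/60` is of order `v²`, and
`7/30 - A'` falls between `7v'` and `14v'`. -/
lemma admissibleState_step {u v A' B' : ℝ} (hu0 : 0 ≤ u) (hu1 : u ≤ 14 * v) (hv0 : 0 < v)
    (hv1 : v ≤ 1 / 60)
    (hB : (B' + 1 / 60) * (60 * (7 / 900 - u / 60 - 7 * v / 60 - v ^ 2)) = v ^ 2)
    (hA : (7 / 30 - A' - 7 * (B' + 1 / 60)) * (7 / 900 - u / 60 - 7 * v / 60 - v ^ 2) =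
      (B' + 1 / 60) * (v / 60 + v ^ 2)) :
    AdmissibleState A' B' ∧ 0 < A' := by
  obtain ⟨E, hE⟩ : ∃ E, E = 7 / 900 - u / 60 - 7 * v / 60 - v ^ 2 := ⟨_, rfl⟩
  obtain ⟨v', hv'⟩ : ∃ v', v' = B' + 1 / 60 := ⟨_, rfl⟩
  obtain ⟨w, hw⟩ : ∃ w, w = 7 / 30 - A' - 7 * v' := ⟨_, rfl⟩
  rw [← hE, ← hv'] at hA hB
  rw [← hw] at hA
  have hvv : v ^ 2 ≤ 1 / 60 * v := by nlinarith
  -- The bounds `u ≤ 14v`, `v² ≤ v/60` and `v ≤ 1/60` give `7/900 - 22/3600 = 1/600`.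
  have hE0 : 1 / 600 ≤ E := by rw [hE]; linarith
  have hEpos : 0 < E := by linarith
  have hv1' : v' = v ^ 2 / (60 * E) := by rw [← hB]; field_simp
  have hw1 : w = v' * (v / 60 + v ^ 2) / E := by rw [← hA]; field_simp
  have hpos : 0 < v' := by rw [hv1']; positivity
  have hle : v' ≤ 1 / 360 := by
    rw [hv1', div_le_iff₀ (by positivity)]
    linarith
  have hw0 : 0 ≤ w := by rw [hw1]; positivity
  have hw2 : w ≤ 7 * v' := by
    rw [hw1, div_le_iff₀ hEpos]
    have h1 : v / 60 + v ^ 2 ≤ 7 * E := by linarith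
    linarith [mul_le_mul_of_nonneg_left h1 hpos.le]
  refine ⟨⟨?_, ?_, ?_, ?_⟩, ?_⟩ <;> linarith

/-- The nodes are the roots of the quadratic orthogonal to `1` and `t` for the left functional
weighted by `(1 - t)²`. Positivity of a Hankel determinant and the signs of the quadratic at `0`,
`1/2`, `1` separate the roots. -/
lemma exists_twoPoint_unit {A B : ℝ} (h : AdmissibleState A B) :
    ∃ τ₁ τ₂ ω₁ ω₂ A' B' : ℝ, 0 < τ₁ ∧ τ₁ < τ₂ ∧ τ₂ < 1 ∧ ω₁ ≠ 0 ∧ ω₂ ≠ 0 ∧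
      AdmissibleState A' B' ∧ 0 < A' ∧ ∀ c : ℕ → ℝ,
        A * quinticValue c 0 + B * quinticSlope c 0 + quinticIntegral c =
          ω₁ * quinticValue c τ₁ + ω₂ * quinticValue c τ₂ +
            A' * quinticValue c 1 + B' * quinticSlope c 1 := by
  obtain ⟨u, hu⟩ : ∃ u, u = 7 / 30 - A := ⟨_, rfl⟩
  obtain ⟨v, hv⟩ : ∃ v, v = B + 1 / 60 := ⟨_, rfl⟩
  obtain rfl : A = 7 / 30 - u := by linarith
  obtain rfl : B = v - 1 / 60 := by linarith
  have hv0 : 0 < v := by have := h.lower; linarith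
  have hv1 : v ≤ 1 / 60 := by have := h.upper; linarith
  have hu0 : 0 ≤ u := by have := h.le_left; linarith
  have hu1 : u ≤ 14 * v := by have := h.le_right; linarith
  have hvv : v ^ 2 ≤ 1 / 60 * v := by nlinarith
  -- `M₀`, `M₁`, `1/30`, `1/60` are the values of the left functional at `(1 - t)² t^j`, `j = 0, …,
  -- 3`; `D` is the Hankel determinant of the first three, and `E` is `D` times the nodal quadratic
  -- at `1`.
  obtain ⟨M₀, hM₀⟩ : ∃ M₀, M₀ = 3 / 5 - u - 2 * v := ⟨_, rfl⟩
  obtain ⟨M₁, hM₁⟩ : ∃ M₁, M₁ = v + 1 / 15 := ⟨_, rfl⟩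
  obtain ⟨D, hD⟩ : ∃ D, D = 7 / 450 - u / 30 - v / 5 - v ^ 2 := ⟨_, rfl⟩
  obtain ⟨E, hE⟩ : ∃ E, E = 7 / 900 - u / 60 - 7 * v / 60 - v ^ 2 := ⟨_, rfl⟩
  have hDM : D = M₀ / 30 - M₁ ^ 2 := by rw [hD, hM₀, hM₁]; ring
  have hE0 : 1 / 600 ≤ E := by rw [hE]; linarith
  have hD0 : 0 < D := by
    rw [hD]
    rw [hE] at hE0
    linarith
  -- Cramer's rule for the two orthogonality conditions, checked in `hm2` and `hm3`.
  obtain ⟨s, hs⟩ : ∃ s, s = (7 / 900 - u / 60 - v / 15) / D := ⟨_, rfl⟩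
  obtain ⟨p, hp⟩ : ∃ p, p = v / 60 / D := ⟨_, rfl⟩
  have hsD : s * D = 7 / 900 - u / 60 - v / 15 := by rw [hs]; field_simp
  have hpD : p * D = v / 60 := by rw [hp]; field_simp
  have hq1 : (1 - s + p) * D = E := by
    rw [hE]; linear_combination (1 : ℝ) * hD - hsD + hpD
  have hqh : (1 / 4 - s / 2 + p) * D = -(v ^ 2 / 4) := by
    linear_combination (1 / 4 : ℝ) * hD - hsD / 2 + hpD
  have hp0 : 0 < p := by rw [hp]; positivity
  have hq1pos : 0 < 1 - s + p := by
    by_contra hc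
    nlinarith [mul_nonneg (sub_nonneg.2 (not_lt.1 hc)) hD0.le]
  have hqhneg : 1 / 4 - s / 2 + p < 0 := by
    by_contra hc
    nlinarith [mul_nonneg (not_lt.1 hc) hD0.le, pow_pos hv0 2]
  have hcont : ∀ x y : ℝ, ContinuousOn (fun t : ℝ => t ^ 2 - s * t + p) (Set.Icc x y) :=
    fun x y => by fun_prop
  obtain ⟨τ₁, ⟨h1a, h1b⟩, hτ₁⟩ : (0 : ℝ) ∈ (fun t : ℝ => t ^ 2 - s * t + p) '' Set.Ioo 0 (1 / 2) :=
    intermediate_value_Ioo' (by norm_num) (hcont 0 (1 / 2))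
      ⟨by norm_num; linarith, by norm_num; exact hp0⟩
  obtain ⟨τ₂, ⟨h2a, h2b⟩, hτ₂⟩ : (0 : ℝ) ∈ (fun t : ℝ => t ^ 2 - s * t + p) '' Set.Ioo (1 / 2) 1 :=
    intermediate_value_Ioo (by norm_num) (hcont (1 / 2) 1)
      ⟨by norm_num; linarith, by norm_num; linarith⟩
  simp only at hτ₁ hτ₂
  have h12 : τ₁ < τ₂ := by linarith
  have hsum : τ₁ + τ₂ = s := by
    have : (τ₁ - τ₂) * (τ₁ + τ₂ - s) = 0 := by linear_combination hτ₁ - hτ₂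
    rcases mul_eq_zero.1 this with h | h <;> linarith
  have hprod : τ₁ * τ₂ = p := by rw [← hsum] at hτ₁; linear_combination -hτ₁
  have hm2 : 1 / 30 - s * M₁ + p * M₀ = 0 := by
    have : (1 / 30 - s * M₁ + p * M₀) * D = 0 := by
      linear_combination (1 / 30 : ℝ) * hD - M₁ * hsD + M₀ * hpD
        + (u / 60 + v / 15 - 7 / 900) * hM₁ + v / 60 * hM₀
    exact (mul_eq_zero.1 this).resolve_right hD0.ne'
  have hm3 : 1 / 60 - s / 30 + p * M₁ = 0 := by
    have : (1 / 60 - s / 30 + p * M₁) * D = 0 := by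
      linear_combination (1 / 60 : ℝ) * hD - (1 / 30 : ℝ) * hsD + M₁ * hpD + v / 60 * hM₁
    exact (mul_eq_zero.1 this).resolve_right hD0.ne'
  have hd : τ₂ - τ₁ ≠ 0 := by linarith
  -- A vanishing weight would make the weighted functional one-point on quadratics, forcing `D = 0`.
  have hne : ∀ σ τ : ℝ, σ + τ = s → σ * τ = p → M₁ - τ * M₀ ≠ 0 := by
    intro σ τ h1 h2 h0
    have h3 : M₁ = τ * M₀ := by linarith
    have : M₀ / 30 = M₁ ^ 2 := by
      rw [← h1, ← h2] at hm2
      linear_combination M₀ * hm2 + (M₀ * σ - M₁) * h0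
    rw [this] at hDM
    linarith
  obtain ⟨ω₁, hω₁⟩ : ∃ ω, ω = (M₁ - τ₂ * M₀) / (τ₁ - τ₂) / (1 - τ₁) ^ 2 := ⟨_, rfl⟩
  obtain ⟨ω₂, hω₂⟩ : ∃ ω, ω = (M₁ - τ₁ * M₀) / (τ₂ - τ₁) / (1 - τ₂) ^ 2 := ⟨_, rfl⟩
  have hd' : τ₁ - τ₂ ≠ 0 := by linarith
  have ht₁ : 1 - τ₁ ≠ 0 := by linarith
  have ht₂ : 1 - τ₂ ≠ 0 := by linarith
  have hW₁ : ω₁ * (1 - τ₁) ^ 2 * (τ₁ - τ₂) = M₁ - τ₂ * M₀ := by rw [hω₁]; field_simp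
  have hW₂ : ω₂ * (1 - τ₂) ^ 2 * (τ₁ - τ₂) = τ₁ * M₀ - M₁ := by
    rw [hω₂]; field_simp; ring
  have e0 : ω₁ * (1 - τ₁) ^ 2 + ω₂ * (1 - τ₂) ^ 2 = M₀ := by
    apply mul_right_cancel₀ hd'
    linear_combination hW₁ + hW₂
  have e1 : ω₁ * (1 - τ₁) ^ 2 * τ₁ + ω₂ * (1 - τ₂) ^ 2 * τ₂ = M₁ := by
    apply mul_right_cancel₀ hd'
    linear_combination τ₁ * hW₁ + τ₂ * hW₂
  have e2 : ω₁ * (1 - τ₁) ^ 2 * τ₁ ^ 2 + ω₂ * (1 - τ₂) ^ 2 * τ₂ ^ 2 = 1 / 30 := by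
    linear_combination ω₁ * (1 - τ₁) ^ 2 * hτ₁ + ω₂ * (1 - τ₂) ^ 2 * hτ₂ + s * e1 - p * e0 - hm2
  have e3 : ω₁ * (1 - τ₁) ^ 2 * τ₁ ^ 3 + ω₂ * (1 - τ₂) ^ 2 * τ₂ ^ 3 = 1 / 60 := by
    linear_combination τ₁ * ω₁ * (1 - τ₁) ^ 2 * hτ₁ + τ₂ * ω₂ * (1 - τ₂) ^ 2 * hτ₂
      + s * e2 - p * e1 - hm3
  -- `A'` and `B'` are forced by exactness on `1` and `t - 1`; the rest of a quintic is `(1 - t)²`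
  -- times a cubic, handled by `e0`–`e3`.
  obtain ⟨A', hA'⟩ : ∃ x, x = (7 / 30 - u) + 1 - ω₁ - ω₂ := ⟨_, rfl⟩
  obtain ⟨B', hB'⟩ : ∃ x, x = (v - 1 / 60) - (7 / 30 - u) - 1 / 2 + ω₁ * (1 - τ₁)
    + ω₂ * (1 - τ₂) := ⟨_, rfl⟩
  have exact : ∀ c : ℕ → ℝ,
        (7 / 30 - u) * quinticValue c 0 + (v - 1 / 60) * quinticSlope c 0 + quinticIntegral c =
          ω₁ * quinticValue c τ₁ + ω₂ * quinticValue c τ₂ +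
            A' * quinticValue c 1 + B' * quinticSlope c 1 := by
    intro c
    simp only [quinticValue, quinticSlope, quinticIntegral]
    rw [hA', hB']
    linear_combination -(c 2 + 2 * c 3 + 3 * c 4 + 4 * c 5) * (e0 + hM₀)
      - (c 3 + 2 * c 4 + 3 * c 5) * (e1 + hM₁) - (c 4 + 2 * c 5) * e2 - c 5 * e3
  have hvE : (B' + 1 / 60) * (60 * E) = v ^ 2 := by
    -- The test polynomial `(t - 1)(t² - s t + p)` vanishes at both nodes and at `1`, so only `B'`
    -- survives on the right.
    have := exact fun i => if i = 0 then -p else if i = 1 then p + s else if i = 2 then -(s + 1)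
      else if i = 3 then 1 else 0
    simp [quinticValue, quinticSlope, quinticIntegral] at this
    have h2 : -(3 / 4 - u - v) * p + s * (v + 3 / 20) - 1 / 12 = B' * (1 - s + p) := by
      linear_combination this + ω₁ * (τ₁ - 1) * hτ₁ + ω₂ * (τ₂ - 1) * hτ₂
    linear_combination (-60 * D) * h2 - 60 * B' * hq1 - 60 * (3 / 4 - u - v) * hpD
      + 60 * (v + 3 / 20) * hsD - 5 * hD + hE
  have huE : (7 / 30 - A' - 7 * (B' + 1 / 60)) * E = (B' + 1 / 60) * (v / 60 + v ^ 2) := by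
    -- The nodal quadratic itself removes both nodes and leaves a relation between `A'` and `B'`.
    have := exact fun i => if i = 0 then p else if i = 1 then -s else if i = 2 then 1 else 0
    simp [quinticValue, quinticSlope, quinticIntegral] at this
    have h2 : p * (37 / 30 - u) - s * (v + 29 / 60) + 1 / 3 =
        A' * (1 - s + p) + B' * (2 - s) := by
      linear_combination this + ω₁ * hτ₁ + ω₂ * hτ₂
    linear_combination D * h2 + A' * hq1 - (37 / 30 - u) * hpD + (v + 29 / 60) * hsD
      - (1 / 3 : ℝ) * hD + 2 * B' * hD - B' * hsD + (11 / 60 - 3 * B') * hE - (1 / 15 : ℝ) * hvE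
  obtain ⟨hA, hB⟩ := admissibleState_step hu0 hu1 hv0 hv1 (hE ▸ hvE) (hE ▸ huE)
  refine ⟨τ₁, τ₂, ω₁, ω₂, A', B', h1a, h12, h2b, ?_, ?_, hA, hB, exact⟩
  · rintro rfl
    exact hne τ₁ τ₂ hsum hprod (by linarith)
  · rintro rfl
    exact hne τ₂ τ₁ (by linarith) (by linarith) (by linarith)

/-! ### Element rules, their scaling and reflection. -/

/-- `μ` transports the boundary functional `α g(l) + β g'(l)` through the interval `[l, r]`. -/
structure IsElementRule (l r α β α' β' : ℝ) (μ : ℝ →₀ ℝ) : Prop where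
  support_subset : ∀ t ∈ μ.support, t ∈ Set.Ioo l r
  exact : ∀ p : Polynomial ℝ, p.natDegree ≤ 5 →
    α * p.eval l + β * p.derivative.eval l + ∫ t in l..r, p.eval t =
      Finsupp.linearCombination ℝ (fun t => p.eval t) μ +
        α' * p.eval r + β' * p.derivative.eval r

lemma eval_eq_quinticValue {p : Polynomial ℝ} (hp : p.natDegree ≤ 5) (t : ℝ) :
    p.eval t = quinticValue p.coeff t := by
  rw [Polynomial.eval_eq_sum_range' (n := 6) (by omega)]
  simp [Finset.sum_range_succ, quinticValue]

lemma eval_derivative_eq_quinticSlope {p : Polynomial ℝ} (hp : p.natDegree ≤ 5) (t : ℝ) :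
    p.derivative.eval t = quinticSlope p.coeff t := by
  rw [Polynomial.eval_eq_sum_range' (n := 5)
    (by have := Polynomial.natDegree_derivative_le p; omega)]
  simp [Finset.sum_range_succ, quinticSlope, Polynomial.coeff_derivative]
  ring

lemma integral_eq_quinticIntegral {p : Polynomial ℝ} (hp : p.natDegree ≤ 5) :
    ∫ t in (0 : ℝ)..1, p.eval t = quinticIntegral p.coeff := by
  simp_rw [Polynomial.eval_eq_sum_range' (n := 6) (by omega : p.natDegree < 6)]
  rw [intervalIntegral.integral_finsetSum
    (fun i _ => (by fun_prop : Continuous fun t : ℝ => p.coeff i * t ^ i).intervalIntegrable _ _)]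
  simp [Finset.sum_range_succ, quinticIntegral]
  ring

lemma isElementRule_unit {A B A' B' : ℝ} {μ : ℝ →₀ ℝ}
    (hμ : ∀ t ∈ μ.support, t ∈ Set.Ioo (0 : ℝ) 1)
    (h : ∀ c : ℕ → ℝ, A * quinticValue c 0 + B * quinticSlope c 0 + quinticIntegral c =
      Finsupp.linearCombination ℝ (quinticValue c) μ +
        A' * quinticValue c 1 + B' * quinticSlope c 1) :
    IsElementRule 0 1 A B A' B' μ := by
  refine ⟨hμ, fun p hp => ?_⟩
  rw [integral_eq_quinticIntegral hp]
  simp_rw [eval_eq_quinticValue hp, eval_derivative_eq_quinticSlope hp]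
  exact h p.coeff

lemma natDegree_comp_affine_le {p : Polynomial ℝ} (hp : p.natDegree ≤ 5) (x h : ℝ) :
    (p.comp (Polynomial.C x + Polynomial.C h * Polynomial.X)).natDegree ≤ 5 := by
  refine Polynomial.natDegree_comp_le.trans ?_
  have : (Polynomial.C x + Polynomial.C h * Polynomial.X).natDegree ≤ 1 := by compute_degree
  nlinarith

lemma IsElementRule.scale {A B A' B' : ℝ} {μ : ℝ →₀ ℝ} (H : IsElementRule 0 1 A B A' B' μ)
    (x : ℝ) {h : ℝ} (hh : 0 < h) :
    IsElementRule x (x + h) (h * A) (h ^ 2 * B) (h * A') (h ^ 2 * B')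
      (h • μ.mapDomain fun t => x + h * t) := by
  constructor
  · intro t ht
    have := Finsupp.mapDomain_support (Finsupp.support_smul ht)
    obtain ⟨s, hs, rfl⟩ := Finset.mem_image.1 this
    obtain ⟨h0, h1⟩ := H.support_subset s hs
    constructor <;> nlinarith
  · intro p hp
    have := H.exact _ (natDegree_comp_affine_le hp x h)
    have hint : ∫ t in (0 : ℝ)..1, p.eval (x + h * t) = h⁻¹ * ∫ t in x..x + h, p.eval t := by
      rw [intervalIntegral.integral_comp_add_mul (fun t => p.eval t) hh.ne']
      simp
    simp [Polynomial.derivative_comp, hint] at this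
    rw [map_smul, Finsupp.linearCombination_mapDomain]
    have h2 : (fun t => Polynomial.eval t p) ∘ (fun t => x + h * t) =
      fun t => p.eval (x + h * t) := rfl
    rw [h2, smul_eq_mul]
    have h3 : h * (h⁻¹ * ∫ t in x..x + h, p.eval t) = ∫ t in x..x + h, p.eval t := by
      field_simp
    linear_combination h * this - h3

/-- Swapping the ends moves each boundary term across the equation and negates it; slopes change
sign once more under `t ↦ c - t`. Hence value coefficients flip and slope coefficients survive. -/
lemma IsElementRule.reflect {l r α β α' β' : ℝ} {μ : ℝ →₀ ℝ} (H : IsElementRule l r α β α' β' μ)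
    (c : ℝ) :
    IsElementRule (c - r) (c - l) (-α') β' (-α) β (μ.mapDomain fun t => c - t) := by
  constructor
  · intro t ht
    obtain ⟨s, hs, rfl⟩ := Finset.mem_image.1 (Finsupp.mapDomain_support ht)
    obtain ⟨h0, h1⟩ := H.support_subset s hs
    constructor <;> linarith
  · intro p hp
    have := H.exact _ (natDegree_comp_affine_le hp c (-1))
    have hint : ∫ t in l..r, p.eval (c + -t) = ∫ t in (c - r)..(c - l), p.eval t := by
      simpa [sub_eq_add_neg] using
        intervalIntegral.integral_comp_sub_left (a := l) (b := r) (fun t => p.eval t) c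
    simp [Polynomial.derivative_comp, hint] at this
    rw [Finsupp.linearCombination_mapDomain]
    have h2 : (fun t => Polynomial.eval t p) ∘ (fun t => c - t) = fun t => p.eval (c + -t) := by
      funext t; simp [sub_eq_add_neg]
    rw [h2]
    simp only [← sub_eq_add_neg] at *
    linarith

/-! ### The symmetric three-point rule for a middle element. -/

/-- With all boundary terms on one side the functional is symmetric about `1/2`, so odd central
moments vanish and only those of orders 0, 2, 4 need matching. -/
lemma exists_threePoint_unit {A B : ℝ} (h : AdmissibleState A B) (hA : 0 ≤ A) :
    ∃ d w w₀ : ℝ, 0 < d ∧ d < 1 / 2 ∧ w ≠ 0 ∧ w₀ ≠ 0 ∧ ∀ c : ℕ → ℝ,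
        A * quinticValue c 0 + B * quinticSlope c 0 + quinticIntegral c =
          w * quinticValue c (1 / 2 - d) + w₀ * quinticValue c (1 / 2) +
            w * quinticValue c (1 / 2 + d) + (-A) * quinticValue c 1 + B * quinticSlope c 1 := by
  have hB1 := h.lower
  have hB2 := h.upper
  obtain ⟨m₂, hm₂⟩ : ∃ m, m = A / 2 - 2 * B + 1 / 12 := ⟨_, rfl⟩
  obtain ⟨m₄, hm₄⟩ : ∃ m, m = A / 8 - B + 1 / 80 := ⟨_, rfl⟩
  have h2 : 0 < m₂ := by linarith
  have h4 : 0 < m₄ := by linarith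
  obtain ⟨d, hd⟩ : ∃ d, d = √(m₄ / m₂) := ⟨_, rfl⟩
  have hd2 : d ^ 2 * m₂ = m₄ := by
    rw [hd, Real.sq_sqrt (by positivity)]; field_simp
  have hd0 : 0 < d := by rw [hd]; positivity
  -- `m₄ < m₂ / 4` is equivalent to `B > -1/60`, the strict bound of the admissible region.
  have hd1 : d < 1 / 2 := by
    by_contra hc
    have : 1 / 4 ≤ d ^ 2 := by nlinarith
    nlinarith
  obtain ⟨w, hw⟩ : ∃ w, w = m₂ / (2 * d ^ 2) := ⟨_, rfl⟩
  have hw0 : 0 < w := by rw [hw]; positivity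
  have hw2 : 2 * w * d ^ 2 = m₂ := by rw [hw]; field_simp
  have hw4 : 2 * w * d ^ 4 = m₄ := by rw [← hd2, ← hw2]; ring
  refine ⟨d, w, 2 * A + 1 - 2 * w, hd0, hd1, hw0.ne', ?_, fun c => ?_⟩
  -- A zero central weight would give `m₀ m₄ = m₂²` with `m₀ = 2A + 1`, but `m₀ m₄ - m₂²` is
  -- positive.
  · intro h0
    have h5 : (2 * A + 1) * m₄ = m₂ ^ 2 := by
      rw [← hw2, ← hw4]; linear_combination (2 * w * d ^ 4) * h0
    rw [hm₂, hm₄] at h5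
    have : A / 15 - 2 * B / 3 - 4 * B ^ 2 + 1 / 180 = 0 := by linear_combination h5
    nlinarith
  · simp only [quinticValue, quinticSlope, quinticIntegral]
    linear_combination -(c 2 + 3 / 2 * c 3 + 3 / 2 * c 4 + 5 / 4 * c 5) * (hw2 + hm₂)
      - (c 4 + 5 / 2 * c 5) * (hw4 + hm₄)

/-! ### Truncated powers and knots. -/

open Filter Topology in
lemma hasDerivAt_max_zero_pow {m : ℕ} (hm : 1 ≤ m) (x : ℝ) :
    HasDerivAt (fun y : ℝ => max y 0 ^ (m + 1)) ((m + 1) * max x 0 ^ m) x := by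
  rcases lt_trichotomy x 0 with hx | rfl | hx
  · rw [max_eq_right hx.le, zero_pow (by omega), mul_zero]
    refine (hasDerivAt_const x (0 : ℝ)).congr_of_eventuallyEq ?_
    filter_upwards [Iio_mem_nhds hx] with y hy
    rw [max_eq_right (le_of_lt hy), zero_pow (by omega)]
  · rw [max_self, zero_pow (by omega), mul_zero, hasDerivAt_iff_isLittleO_nhds_zero]
    have h1 : (fun h : ℝ => max h 0 ^ (m + 1)) =O[𝓝 0] fun h : ℝ => h ^ (m + 1) := by
      refine Asymptotics.isBigO_of_le _ fun h => ?_
      rw [norm_pow, norm_pow]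
      gcongr
      rcases le_total h 0 with h0 | h0
      · simp [h0]
      · simp [h0]
    simpa using h1.trans_isLittleO (Asymptotics.isLittleO_pow_id (by omega))
  · rw [max_eq_left hx.le]
    have := hasDerivAt_pow (m + 1) x
    simp only [Nat.cast_add, Nat.cast_one, Nat.add_sub_cancel] at this
    refine this.congr_of_eventuallyEq ?_
    filter_upwards [Ioi_mem_nhds hx] with y hy
    rw [max_eq_left (le_of_lt hy)]

lemma knot_succ (a b : ℝ) (n k : ℕ) : knot a b n (k + 1) = knot a b n k + (b - a) / n := by
  simp only [knot]; push_cast; ring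

lemma knot_strictMono {a b : ℝ} (hab : a < b) {n : ℕ} (hn : 1 ≤ n) : StrictMono (knot a b n) := by
  have : (0 : ℝ) < n := by exact_mod_cast hn
  refine strictMono_nat_of_lt_succ fun k => ?_
  rw [knot_succ]
  linarith [div_pos (sub_pos.2 hab) this]

lemma knot_zero (a b : ℝ) (n : ℕ) : knot a b n 0 = a := by simp [knot]

lemma knot_self (a b : ℝ) {n : ℕ} (hn : 1 ≤ n) : knot a b n n = b := by
  have : (n : ℝ) ≠ 0 := by positivity
  simp only [knot]; field_simp; ring

lemma isC1QuinticSpline_truncatedPower {a b : ℝ} (hab : a < b) {n : ℕ} (hn : 1 ≤ n) (j : ℕ)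
    {m : ℕ} (hm : 1 ≤ m) (hm' : m ≤ 4) :
    IsC1QuinticSpline a b n fun t => max (t - knot a b n j) 0 ^ (m + 1) := by
  constructor
  · have h : ∀ t, HasDerivAt (fun t => max (t - knot a b n j) 0 ^ (m + 1))
        ((m + 1) * max (t - knot a b n j) 0 ^ m) t := fun t => by
      have := (hasDerivAt_max_zero_pow hm (t - knot a b n j)).comp t
        ((hasDerivAt_id t).sub_const (knot a b n j))
      exact this.congr_deriv (mul_one _)
    refine ContDiff.contDiffOn (contDiff_one_iff_deriv.2 ⟨fun t => (h t).differentiableAt, ?_⟩)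
    rw [funext fun t => (h t).deriv]
    fun_prop
  · intro k hk hkn
    rcases Nat.lt_or_ge j k with h | h
    · refine ⟨(Polynomial.X - Polynomial.C (knot a b n j)) ^ (m + 1), ?_, fun t ht => ?_⟩
      · rw [Polynomial.natDegree_pow, Polynomial.natDegree_X_sub_C]; omega
      · have h1 := (knot_strictMono hab hn).monotone (by omega : j ≤ k - 1)
        have h2 : knot a b n j ≤ t := h1.trans (le_of_lt ht.1)
        simp [max_eq_left (sub_nonneg.2 h2)]
    · refine ⟨0, by simp, fun t ht => ?_⟩
      have h1 := (knot_strictMono hab hn).monotone h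
      have h2 : t < knot a b n k := ht.2
      simp [max_eq_right (by linarith : t - knot a b n j ≤ 0)]

lemma isC1QuinticSpline_affine (a b : ℝ) (n : ℕ) (c d : ℝ) :
    IsC1QuinticSpline a b n fun t => c * t + d := by
  refine ⟨by fun_prop, fun k _ _ => ⟨Polynomial.C c * Polynomial.X + Polynomial.C d, ?_, ?_⟩⟩
  · exact (by compute_degree : _ ≤ 1).trans (by norm_num)
  · intro t _; simp

/-! ### Peano kernels and their breakpoints. -/

/-- The value of the atomic functional `D` at the truncated power `(· - t)₊ ^ m`. -/
noncomputable def peanoKernel (D : ℝ →₀ ℝ) (m : ℕ) (t : ℝ) : ℝ :=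
  Finsupp.linearCombination ℝ (fun τ => max (τ - t) 0 ^ m) D

lemma peanoKernel_eq_sum (D : ℝ →₀ ℝ) (m : ℕ) (t : ℝ) :
    peanoKernel D m t = ∑ τ ∈ D.support, D τ * max (τ - t) 0 ^ m := by
  simp [peanoKernel, Finsupp.linearCombination_apply, Finsupp.sum]

lemma hasDerivAt_peanoKernel (D : ℝ →₀ ℝ) {m : ℕ} (hm : 1 ≤ m) (t : ℝ) :
    HasDerivAt (peanoKernel D (m + 1)) (-(m + 1) * peanoKernel D m t) t := by
  rw [funext (peanoKernel_eq_sum D (m + 1)), peanoKernel_eq_sum, Finset.mul_sum]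
  refine HasDerivAt.fun_sum fun τ _ => ?_
  have := ((hasDerivAt_max_zero_pow hm (τ - t)).comp t
    ((hasDerivAt_id t).const_sub τ)).const_mul (D τ)
  exact this.congr_deriv (by ring)

lemma continuous_peanoKernel (D : ℝ →₀ ℝ) (m : ℕ) : Continuous (peanoKernel D m) := by
  rw [funext (peanoKernel_eq_sum D m)]
  fun_prop

lemma peanoKernel_affine {D : ℝ →₀ ℝ} {p q : ℝ} (h : ∀ τ ∈ D.support, τ ∉ Set.Ioo p q) :
    ∃ α β : ℝ, ∀ s ∈ Set.Icc p q, peanoKernel D 1 s = α + β * s := by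
  refine ⟨∑ τ ∈ D.support, D τ * (if τ ≤ p then 0 else τ),
    ∑ τ ∈ D.support, D τ * (if τ ≤ p then 0 else -1), fun s hs => ?_⟩
  rw [peanoKernel_eq_sum, Finset.sum_mul, ← Finset.sum_add_distrib]
  refine Finset.sum_congr rfl fun τ hτ => ?_
  split_ifs with hp
  · rw [max_eq_right (by linarith [hs.1])]; ring
  · have : q ≤ τ := by
      by_contra hq
      exact h τ hτ ⟨not_le.1 hp, not_le.1 hq⟩
    rw [max_eq_left (by linarith [hs.2])]; ring

lemma peanoKernel_eq_zero {D : ℝ →₀ ℝ} {p q u v : ℝ} (h : ∀ τ ∈ D.support, τ ∉ Set.Ioo p q)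
    (hu : u ∈ Set.Icc p q) (hv : v ∈ Set.Icc p q) (huv : u ≠ v)
    (hKu : peanoKernel D 1 u = 0) (hKv : peanoKernel D 1 v = 0) :
    ∀ s ∈ Set.Icc p q, peanoKernel D 1 s = 0 := by
  obtain ⟨α, β, H⟩ := peanoKernel_affine h
  rw [H u hu] at hKu
  rw [H v hv] at hKv
  have hβ : β = 0 := by
    have : β * (u - v) = 0 := by linear_combination hKu - hKv
    exact (mul_eq_zero.1 this).resolve_right (sub_ne_zero.2 huv)
  intro s hs
  rw [H s hs]
  simp only [hβ] at hKu ⊢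
  linarith

-- The slope of the kernel jumps by `D τ` at `τ`. A second difference whose step is shorter than the
-- distance to every other atom isolates this jump.
open Filter Topology in
lemma apply_eq_zero_of_peanoKernel {D : ℝ →₀ ℝ} {u v : ℝ}
    (h : ∀ s ∈ Set.Ioo u v, peanoKernel D 1 s = 0) {τ : ℝ} (hτ : τ ∈ Set.Ioo u v) : D τ = 0 := by
  have h1 : ∀ᶠ s in 𝓝 τ, s ∈ Set.Ioo u v := Ioo_mem_nhds hτ.1 hτ.2
  have h2 : ∀ᶠ s in 𝓝 τ, ∀ σ ∈ D.support.erase τ, s ≠ σ := by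
    rw [Filter.eventually_all_finset]
    intro σ hσ
    exact eventually_ne_nhds (Finset.ne_of_mem_erase hσ).symm
  obtain ⟨ε, hε, H⟩ := Metric.eventually_nhds_iff.1 (h1.and h2)
  have hd : ∀ x : ℝ, |x| ≤ ε / 2 → dist (τ + x) τ < ε := fun x hx => by
    rw [Real.dist_eq, add_sub_cancel_left]; linarith
  have e1 := h _ (H (hd (ε / 2) (by rw [abs_of_pos]; linarith))).1
  have e2 := h _ (H (hd (-(ε / 2)) (by rw [abs_neg, abs_of_pos]; linarith))).1
  have e3 := h _ hτ
  rw [peanoKernel_eq_sum] at e1 e2 e3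
  have : ∑ σ ∈ D.support, D σ * (max (σ - (τ + ε / 2)) 0 ^ 1 + max (σ - (τ + -(ε / 2))) 0 ^ 1
      - 2 * max (σ - τ) 0 ^ 1) = 0 := by
    simp only [mul_sub, mul_add, Finset.sum_sub_distrib, Finset.sum_add_distrib]
    rw [e1, e2]
    simp only [mul_left_comm _ (2 : ℝ), ← Finset.mul_sum, e3]
    ring
  by_contra hne
  rw [Finset.sum_eq_single_of_mem τ (Finsupp.mem_support_iff.2 hne)] at this
  · rw [max_eq_right (by linarith), max_eq_left (by linarith), max_eq_right (by linarith)] at this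
    have h3 : D τ * (ε / 2) = 0 := by linear_combination this
    rcases mul_eq_zero.1 h3 with h3 | h3
    · exact hne h3
    · linarith
  · intro σ hσ hστ
    have hfar : ∀ x : ℝ, |x| ≤ ε / 2 → τ + x ≠ σ := fun x hx =>
      (H (hd x hx)).2 σ (Finset.mem_erase.2 ⟨hστ, hσ⟩)
    have habs : ε / 2 < |σ - τ| := by
      by_contra hc
      exact hfar (σ - τ) (not_lt.1 hc) (by ring)
    rcases lt_abs.1 habs with h3 | h3
    · rw [max_eq_left (by linarith), max_eq_left (by linarith), max_eq_left (by linarith)]; ring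
    · rw [max_eq_right (by linarith), max_eq_right (by linarith), max_eq_right (by linarith)]; ring

lemma exists_breakpoint {D : ℝ →₀ ℝ} {p y q : ℝ} (hpy : p < y) (hyq : y < q)
    (hp : peanoKernel D 1 p = 0) (hq : peanoKernel D 1 q = 0) (hy : peanoKernel D 1 y ≠ 0) :
    ∃ τ ∈ D.support, p < τ ∧ τ < q := by
  by_contra! hc
  exact hy (peanoKernel_eq_zero (fun τ hτ h => (hc τ hτ h.1).not_gt h.2)
    ⟨le_rfl, by linarith⟩ ⟨by linarith, le_rfl⟩ (by linarith) hp hq y ⟨hpy.le, hyq.le⟩)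

/-- One break is needed to leave the zero stretch and another to come back to zero: a single break
would leave a linear piece with zeros at both ends. -/
lemma exists_two_breakpoints_right {D : ℝ →₀ ℝ} {u p y q : ℝ} (hup : u < p) (hpy : p < y)
    (hyq : y < q) (hz : ∀ s ∈ Set.Icc u p, peanoKernel D 1 s = 0)
    (hq : peanoKernel D 1 q = 0) (hy : peanoKernel D 1 y ≠ 0) :
    ∃ τ ∈ D.support, ∃ σ ∈ D.support, p ≤ τ ∧ τ < σ ∧ σ < q := by
  have hp : peanoKernel D 1 p = 0 := hz p ⟨hup.le, le_rfl⟩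
  obtain ⟨τ, hτ, h1, h2⟩ := exists_breakpoint hpy hyq hp hq hy
  by_contra! hc
  have hno : ∀ σ ∈ D.support, σ ∉ Set.Ioo u τ := by
    rintro σ hσ ⟨h3, h4⟩
    rcases lt_or_ge σ p with h5 | h5
    · exact Finsupp.mem_support_iff.1 hσ (apply_eq_zero_of_peanoKernel
        (fun s hs => hz s ⟨hs.1.le, hs.2.le⟩) ⟨h3, h5⟩)
    · exact (hc σ hσ τ hτ h5 h4).not_gt h2
  have hl := peanoKernel_eq_zero hno ⟨le_rfl, by linarith⟩ ⟨hup.le, h1.le⟩ hup.ne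
    (hz u ⟨le_rfl, hup.le⟩) hp
  have hr := peanoKernel_eq_zero (D := D) (p := τ) (q := q) (u := τ) (v := q)
    (fun σ hσ h => (hc τ hτ σ hσ h1.le h.1).not_gt h.2)
    ⟨le_rfl, h2.le⟩ ⟨h2.le, le_rfl⟩ h2.ne (hl τ ⟨by linarith, le_rfl⟩) hq
  rcases le_total y τ with h5 | h5
  · exact hy (hl y ⟨by linarith, h5⟩)
  · exact hy (hr y ⟨h5, hyq.le⟩)

lemma exists_two_breakpoints_left {D : ℝ →₀ ℝ} {z y p v : ℝ} (hzy : z < y) (hyp : y < p)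
    (hpv : p < v) (hz : ∀ s ∈ Set.Icc p v, peanoKernel D 1 s = 0)
    (hKz : peanoKernel D 1 z = 0) (hy : peanoKernel D 1 y ≠ 0) :
    ∃ τ ∈ D.support, ∃ σ ∈ D.support, z < τ ∧ τ < σ ∧ σ ≤ p := by
  have hp : peanoKernel D 1 p = 0 := hz p ⟨le_rfl, hpv.le⟩
  obtain ⟨τ, hτ, h1, h2⟩ := exists_breakpoint hzy hyp hKz hp hy
  by_contra! hc
  have hno : ∀ σ ∈ D.support, σ ∉ Set.Ioo τ v := by
    rintro σ hσ ⟨h3, h4⟩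
    rcases lt_or_ge p σ with h5 | h5
    · exact Finsupp.mem_support_iff.1 hσ (apply_eq_zero_of_peanoKernel
        (fun s hs => hz s ⟨hs.1.le, hs.2.le⟩) ⟨h5, h4⟩)
    · exact (hc τ hτ σ hσ h1 h3).not_ge h5
  have hr := peanoKernel_eq_zero hno ⟨h2.le, hpv.le⟩ ⟨by linarith, le_rfl⟩ hpv.ne
    hp (hz v ⟨hpv.le, le_rfl⟩)
  have hl := peanoKernel_eq_zero (D := D) (p := z) (q := τ) (u := z) (v := τ)
    (fun σ hσ h => (hc σ hσ τ hτ h.1 h.2).not_ge h2.le)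
    ⟨le_rfl, h1.le⟩ ⟨h1.le, le_rfl⟩ h1.ne hKz (hr τ ⟨le_rfl, by linarith⟩)
  rcases le_total y τ with h5 | h5
  · exact hy (hl y ⟨hzy.le, h5⟩)
  · exact hy (hr y ⟨h5, by linarith⟩)

/-! ### Sign alternation and Rolle's theorem. -/

/-- `F` takes values of alternating sign at `m` points of `(l, r)`. -/
def Alternates (F : ℝ → ℝ) (l r : ℝ) (m : ℕ) : Prop :=
  ∃ (Y : ℕ → ℝ) (ε : ℝ), Y 0 = l ∧ Y (m + 1) = r ∧ (∀ i ≤ m, Y i < Y (i + 1)) ∧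
    ∀ i < m, 0 < ε * (-1) ^ i * F (Y (i + 1))

/-- The zeros at the two ends turn `m + 1` alternating values into `m + 2` alternating increments,
and the mean value theorem passes these to the derivative. -/
lemma Alternates.of_hasDerivAt {F F' : ℝ → ℝ} {l r c : ℝ} {m : ℕ}
    (h : Alternates F l r (m + 1)) (hF : ∀ t, HasDerivAt F (c * F' t) t) (hl : F l = 0)
    (hr : F r = 0) : Alternates F' l r (m + 2) := by
  obtain ⟨Y, ε, hY0, hYr, hY, hs⟩ := h
  have hdiff : ∀ i ≤ m + 1, 0 < ε * (-1) ^ i * (F (Y (i + 1)) - F (Y i)) := by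
    intro i hi
    have h1 : 0 ≤ ε * (-1) ^ i * F (Y (i + 1)) := by
      rcases Nat.lt_or_ge i (m + 1) with h | h
      · exact (hs i h).le
      · obtain rfl : i = m + 1 := by omega
        rw [hYr, hr, mul_zero]
    rcases i with _ | i
    · have := hs 0 (by omega)
      rw [hY0, hl, sub_zero]
      exact this
    · have := hs i (by omega)
      rw [pow_succ] at h1 ⊢
      linarith
  have hmvt : ∀ i, ∃ w, i ≤ m + 1 → (Y i < w ∧ w < Y (i + 1)) ∧ 0 < ε * (-1) ^ i * (c * F' w) := by
    intro i
    by_cases hi : i ≤ m + 1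
    · obtain ⟨w, hw, he⟩ := exists_hasDerivAt_eq_slope F (fun t => c * F' t) (hY i hi)
        (fun t _ => (hF t).continuousAt.continuousWithinAt) (fun t _ => hF t)
      refine ⟨w, fun _ => ⟨hw, ?_⟩⟩
      rw [he, ← mul_div_assoc]
      exact div_pos (hdiff i hi) (sub_pos.2 (hY i hi))
    · exact ⟨0, fun h => absurd h hi⟩
  choose w hw using hmvt
  -- The indices of `w` shift by one to make room for `l`; the sign constant absorbs `c`.
  refine ⟨fun j => if j = 0 then l else if j ≤ m + 2 then w (j - 1) else r, ε * c,
    by simp, by simp, fun i hi => ?_, fun i hi => ?_⟩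
  · rcases i with _ | i
    · have := (hw 0 (by omega)).1.1
      rw [hY0] at this
      simpa using this
    · rcases Nat.lt_or_ge i (m + 1) with h | h
      · simpa [h, (by omega : i ≤ m + 1), (by omega : i ≤ m)] using
          (hw i (by omega)).1.2.trans (hw (i + 1) (by omega)).1.1
      · obtain rfl : i = m + 1 := by omega
        have := (hw (m + 1) (by omega)).1.2
        rw [hYr] at this
        simpa using this
  · have := (hw i (by omega)).2
    simp only [Nat.add_eq_zero_iff, one_ne_zero, and_false, if_false, Nat.add_sub_cancel]
    rw [if_pos (by omega)]
    linarith

lemma exists_zero_between {F : ℝ → ℝ} (hF : Continuous F) {x y : ℝ} (hxy : x < y)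
    (h : F x * F y < 0) : ∃ z, x < z ∧ z < y ∧ F z = 0 := by
  rcases mul_neg_iff.1 h with ⟨h1, h2⟩ | ⟨h1, h2⟩
  · obtain ⟨z, hz, h0⟩ := intermediate_value_Ioo' hxy.le hF.continuousOn ⟨h2, h1⟩
    exact ⟨z, hz.1, hz.2, h0⟩
  · obtain ⟨z, hz, h0⟩ := intermediate_value_Ioo hxy.le hF.continuousOn ⟨h1, h2⟩
    exact ⟨z, hz.1, hz.2, h0⟩

lemma Alternates.exists_zeros {F : ℝ → ℝ} (hF : Continuous F) {l r : ℝ} {m : ℕ}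
    (h : Alternates F l r (m + 1)) : ∃ y z : ℕ → ℝ, l < y 0 ∧ y m < r ∧ (∀ i ≤ m, F (y i) ≠ 0) ∧
      ∀ i < m, y i < z i ∧ z i < y (i + 1) ∧ F (z i) = 0 := by
  obtain ⟨Y, ε, hY0, hYr, hY, hs⟩ := h
  have hz : ∀ i, ∃ z, i < m → Y (i + 1) < z ∧ z < Y (i + 2) ∧ F z = 0 := by
    intro i
    by_cases hi : i < m
    · have h1 := hs i (by omega)
      have h2 := hs (i + 1) (by omega)
      have : F (Y (i + 1)) * F (Y (i + 2)) < 0 := by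
        have h3 := mul_pos h1 h2
        have hsq : ((-1 : ℝ) ^ i) ^ 2 = 1 := by rw [← pow_mul, mul_comm, pow_mul]; simp
        have h4 : ε * (-1) ^ i * F (Y (i + 1)) * (ε * (-1) ^ (i + 1) * F (Y (i + 1 + 1))) =
            -(ε ^ 2 * (F (Y (i + 1)) * F (Y (i + 2)))) := by
          rw [pow_succ]
          linear_combination (-(ε ^ 2 * (F (Y (i + 1)) * F (Y (i + 2))))) * hsq
        rw [h4] at h3
        by_contra hc
        nlinarith [mul_nonneg (sq_nonneg ε) (not_lt.1 hc)]
      obtain ⟨z, hz⟩ := exists_zero_between hF (hY (i + 1) (by omega)) this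
      exact ⟨z, fun _ => hz⟩
    · exact ⟨0, fun h => absurd h hi⟩
  choose z hz using hz
  refine ⟨fun i => Y (i + 1), z, ?_, ?_, fun i hi h0 => ?_, hz⟩
  · simpa [hY0] using hY 0 (by omega)
  · simpa [hYr] using hY (m + 1) le_rfl
  · have := hs i (by omega)
    simp [h0] at this

lemma peanoKernel_eq_zero_of_succ {D : ℝ →₀ ℝ} {m : ℕ} (hm : 1 ≤ m) {l r : ℝ}
    (h : ∀ t ∈ Set.Ioo l r, peanoKernel D (m + 1) t = 0) :
    ∀ t ∈ Set.Ioo l r, peanoKernel D m t = 0 := by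
  intro t ht
  have h1 : HasDerivAt (peanoKernel D (m + 1)) 0 t := by
    refine (hasDerivAt_const t (0 : ℝ)).congr_of_eventuallyEq ?_
    filter_upwards [Ioo_mem_nhds ht.1 ht.2] with s hs using h s hs
  have h2 := h1.unique (hasDerivAt_peanoKernel D hm t)
  exact (mul_eq_zero.1 h2.symm).resolve_left (by linarith [(Nat.cast_nonneg m : (0 : ℝ) ≤ m)])

/-- The order 5 kernel is nonzero somewhere, since otherwise differentiation would annihilate the
order 1 kernel. Four Rolle steps then raise one sign to five. -/
lemma peanoKernel_alternates {D : ℝ →₀ ℝ} {l r : ℝ}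
    (hl : ∀ m, 1 ≤ m → m ≤ 4 → peanoKernel D (m + 1) l = 0)
    (hr : ∀ m, 1 ≤ m → m ≤ 4 → peanoKernel D (m + 1) r = 0)
    (h : ∃ t ∈ Set.Ioo l r, peanoKernel D 1 t ≠ 0) : Alternates (peanoKernel D 1) l r 5 := by
  have h5 : ∃ t ∈ Set.Ioo l r, peanoKernel D 5 t ≠ 0 := by
    by_contra! hc
    obtain ⟨t, ht, hne⟩ := h
    exact hne (peanoKernel_eq_zero_of_succ le_rfl (peanoKernel_eq_zero_of_succ (by norm_num)
      (peanoKernel_eq_zero_of_succ (by norm_num) (peanoKernel_eq_zero_of_succ (by norm_num) hc)))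
      t ht)
  obtain ⟨t, ht, hne⟩ := h5
  have A1 : Alternates (peanoKernel D 5) l r 1 := by
    refine ⟨fun i => if i = 0 then l else if i = 1 then t else r, peanoKernel D 5 t,
      by simp, by simp, fun i hi => ?_, fun i hi => ?_⟩
    · interval_cases i
      · simpa using ht.1
      · simpa using ht.2
    · interval_cases i
      simpa using mul_self_pos.2 hne
  have A2 := A1.of_hasDerivAt (hasDerivAt_peanoKernel D (by norm_num : 1 ≤ 4))
    (hl 4 (by norm_num) (by norm_num)) (hr 4 (by norm_num) (by norm_num))
  have A3 := A2.of_hasDerivAt (hasDerivAt_peanoKernel D (by norm_num : 1 ≤ 3))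
    (hl 3 (by norm_num) (by norm_num)) (hr 3 (by norm_num) (by norm_num))
  have A4 := A3.of_hasDerivAt (hasDerivAt_peanoKernel D (by norm_num : 1 ≤ 2))
    (hl 2 (by norm_num) (by norm_num)) (hr 2 (by norm_num) (by norm_num))
  exact A4.of_hasDerivAt (hasDerivAt_peanoKernel D (by norm_num : 1 ≤ 1))
    (hl 1 (by norm_num) (by norm_num)) (hr 1 (by norm_num) (by norm_num))

/-! ### Counting nodes against breakpoints. -/

/-- The number of points of `X` and of `Y` in `S`, common points counted twice. -/
noncomputable def pointCount (X Y : Finset ℝ) (S : Set ℝ) : ℕ :=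
  ((X : Set ℝ) ∩ S).ncard + ((Y : Set ℝ) ∩ S).ncard

lemma pointCount_add_le (X Y : Finset ℝ) {S T U : Set ℝ} (hS : S ⊆ U) (hT : T ⊆ U)
    (hST : Disjoint S T) : pointCount X Y S + pointCount X Y T ≤ pointCount X Y U := by
  have key : ∀ Z : Finset ℝ, ((Z : Set ℝ) ∩ S).ncard + ((Z : Set ℝ) ∩ T).ncard ≤
      ((Z : Set ℝ) ∩ U).ncard := fun Z => by
    rw [← Set.ncard_union_eq (hST.mono Set.inter_subset_right Set.inter_subset_right)
      (Z.finite_toSet.inter_of_left _) (Z.finite_toSet.inter_of_left _),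
      ← Set.inter_union_distrib_left]
    exact Set.ncard_le_ncard (Set.inter_subset_inter_right _ (Set.union_subset hS hT))
      (Z.finite_toSet.inter_of_left _)
  have h1 := key X
  have h2 := key Y
  simp only [pointCount]
  omega

lemma pointCount_le (X Y : Finset ℝ) (S : Set ℝ) : pointCount X Y S ≤ X.card + Y.card := by
  have key : ∀ Z : Finset ℝ, ((Z : Set ℝ) ∩ S).ncard ≤ Z.card := fun Z => by
    rw [← Set.ncard_coe_finset]
    exact Set.ncard_le_ncard Set.inter_subset_left Z.finite_toSet
  exact add_le_add (key X) (key Y)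

lemma one_le_pointCount {X Y : Finset ℝ} {S : Set ℝ} {τ : ℝ} (hτ : τ ∈ X ∪ Y) (hS : τ ∈ S) :
    1 ≤ pointCount X Y S := by
  have key : ∀ Z : Finset ℝ, τ ∈ Z → 1 ≤ ((Z : Set ℝ) ∩ S).ncard := fun Z hZ =>
    (Set.ncard_pos (Z.finite_toSet.inter_of_left _)).2 ⟨τ, hZ, hS⟩
  rw [pointCount]
  rcases Finset.mem_union.1 hτ with h | h
  · have := key X h; omega
  · have := key Y h; omega

lemma two_le_pointCount {X Y : Finset ℝ} {S : Set ℝ} {τ σ : ℝ} (hτ : τ ∈ X ∪ Y) (hσ : σ ∈ X ∪ Y)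
    (hτS : τ ∈ S) (hσS : σ ∈ S) (h : τ ≠ σ) : 2 ≤ pointCount X Y S := by
  have h1 := pointCount_add_le X Y (S := {τ}) (T := {σ}) (U := S) (by simpa using hτS)
    (by simpa using hσS) (by simpa using h)
  have h2 := one_le_pointCount hτ (Set.mem_singleton τ)
  have h3 := one_le_pointCount hσ (Set.mem_singleton σ)
  omega

/-- An atomic functional annihilating all splines vanishes if it is supported on few points. -/
theorem eq_zero_of_annihilates {a b : ℝ} (hab : a < b) {n : ℕ} (hn : 1 ≤ n) {D : ℝ →₀ ℝ}
    {X Y : Finset ℝ} (hD : ∀ τ ∈ D.support, τ ∈ Set.Icc a b)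
    (hann : ∀ f, IsC1QuinticSpline a b n f → Finsupp.linearCombination ℝ f D = 0)
    (hXY : D.support ⊆ X ∪ Y) (hcard : X.card + Y.card ≤ 4 * n + 2)
    (hzero : ∀ k < n, (∀ t ∈ Set.Ioo (knot a b n k) (knot a b n (k + 1)), D t = 0) →
      4 ≤ pointCount X Y (Set.Ioo (knot a b n k) (knot a b n (k + 1)))) : D = 0 := by
  have hmono := knot_strictMono hab hn
  have hknot : ∀ k m, 1 ≤ m → m ≤ 4 → peanoKernel D (m + 1) (knot a b n k) = 0 :=
    fun k m h1 h4 => hann _ (isC1QuinticSpline_truncatedPower hab hn k h1 h4)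
  -- For `s ≤ a` the truncation is inactive on `[a, b]`, so `D` acts on an affine function.
  have hleft : ∀ s ≤ a, peanoKernel D 1 s = 0 := by
    intro s hs
    rw [← hann _ (isC1QuinticSpline_affine a b n 1 (-s)), peanoKernel_eq_sum,
      Finsupp.linearCombination_apply, Finsupp.sum]
    refine Finset.sum_congr rfl fun τ hτ => ?_
    rw [max_eq_left (by linarith [(hD τ hτ).1]), smul_eq_mul]
    ring
  have hright : ∀ s, b ≤ s → peanoKernel D 1 s = 0 := by
    intro s hs
    rw [peanoKernel_eq_sum]
    refine Finset.sum_eq_zero fun τ hτ => ?_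
    rw [max_eq_right (by linarith [(hD τ hτ).2])]
    ring
  have hcl : ∀ k, (∀ t ∈ Set.Ioo (knot a b n k) (knot a b n (k + 1)), peanoKernel D 1 t = 0) →
      ∀ t ∈ Set.Icc (knot a b n k) (knot a b n (k + 1)), peanoKernel D 1 t = 0 := by
    intro k hk
    have h1 : IsClosed {t | peanoKernel D 1 t = 0} :=
      isClosed_eq (continuous_peanoKernel D 1) continuous_const
    rw [← closure_Ioo (hmono (Nat.lt_succ_self k)).ne]
    exact fun t ht => closure_minimal hk h1 ht
  -- the count up to the `k`-th knot, or up to the last known zero before it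
  have main : ∀ k ≤ n,
      ((∃ u < knot a b n k, ∀ s ∈ Set.Icc u (knot a b n k), peanoKernel D 1 s = 0) ∧
        4 * k ≤ pointCount X Y (Set.Iio (knot a b n k)) ∧
        ((∃ t < knot a b n k, peanoKernel D 1 t ≠ 0) →
          4 * k + 3 ≤ pointCount X Y (Set.Iio (knot a b n k)))) ∨
      ∃ z y, z < y ∧ y < knot a b n k ∧ peanoKernel D 1 z = 0 ∧ peanoKernel D 1 y ≠ 0 ∧
        4 * k + 1 ≤ pointCount X Y (Set.Iio z) := by
    intro k
    induction k with
    | zero =>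
      intro _
      left
      rw [knot_zero]
      refine ⟨⟨a - 1, by linarith, fun s hs => hleft s hs.2⟩, by omega, ?_⟩
      rintro ⟨t, ht, hne⟩
      exact absurd (hleft t ht.le) hne
    | succ k ih =>
      intro hk
      have hlt := hmono (Nat.lt_succ_self k)
      by_cases hJ : ∃ t ∈ Set.Ioo (knot a b n k) (knot a b n (k + 1)), peanoKernel D 1 t ≠ 0
      · right
        obtain ⟨y, z, hy0, hy4, hy, hz⟩ :=
          (peanoKernel_alternates (hknot k) (hknot (k + 1)) hJ).exists_zeros
            (continuous_peanoKernel D 1)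
        have gap : ∀ i < 3, pointCount X Y (Set.Iio (z i)) + 1 ≤
            pointCount X Y (Set.Iio (z (i + 1))) := by
          intro i hi
          obtain ⟨τ, hτ, h1, h2⟩ := exists_breakpoint (hz i (by omega)).2.1
            (hz (i + 1) (by omega)).1 (hz i (by omega)).2.2 (hz (i + 1) (by omega)).2.2
            (hy (i + 1) (by omega))
          refine le_trans ?_ (pointCount_add_le X Y (S := Set.Iio (z i))
            (T := Set.Ico (z i) (z (i + 1))) ?_ ?_ ?_)
          · exact Nat.add_le_add_left
              (one_le_pointCount (S := Set.Ico (z i) (z (i + 1))) (hXY hτ) ⟨h1.le, h2⟩) _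
          · exact Set.Iio_subset_Iio (h1.trans h2).le
          · exact fun s hs => hs.2
          · exact Set.disjoint_left.2 fun s hs hs' => not_lt.2 hs'.1 hs
        have g0 := gap 0 (by omega)
        have g1 := gap 1 (by omega)
        have g2 := gap 2 (by omega)
        refine ⟨z 3, y 4, (hz 3 (by omega)).2.1, hy4, (hz 3 (by omega)).2.2, hy 4 le_rfl, ?_⟩
        have hz0 := hz 0 (by omega)
        -- The three gaps between the four zeros add 3, giving `4 * (k + 1) + 1`. The bound before
        -- `z 0` comes from two breaks after a zero stretch, or from one break after the pending
        -- zero `z'`.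
        suffices 4 * k + 2 ≤ pointCount X Y (Set.Iio (z 0)) by
          simp only [zero_add, Nat.reduceAdd] at g0 g1 g2
          omega
        rcases ih (by omega) with ⟨⟨u, hu, hu0⟩, hc, -⟩ | ⟨z', y', hzy, hyk, hKz, hKy, hc⟩
        · obtain ⟨τ, hτ, σ, hσ, h1, h2, h3⟩ :=
            exists_two_breakpoints_right hu hy0 hz0.1 hu0 hz0.2.2 (hy 0 (by omega))
          have h5 := two_le_pointCount (S := Set.Ico (knot a b n k) (z 0)) (hXY hτ) (hXY hσ)
            ⟨h1, by linarith⟩ ⟨by linarith, h3⟩ h2.ne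
          have h6 := pointCount_add_le X Y (S := Set.Iio (knot a b n k))
            (T := Set.Ico (knot a b n k) (z 0)) (U := Set.Iio (z 0))
            (Set.Iio_subset_Iio (by linarith)) (fun s hs => hs.2)
            (Set.disjoint_left.2 fun s hs hs' => not_lt.2 hs'.1 hs)
          omega
        · obtain ⟨τ, hτ, h1, h2⟩ := exists_breakpoint hzy (by linarith : y' < z 0) hKz hz0.2.2 hKy
          have h5 := one_le_pointCount (S := Set.Ico z' (z 0)) (hXY hτ) ⟨h1.le, h2⟩
          have h6 := pointCount_add_le X Y (S := Set.Iio z') (T := Set.Ico z' (z 0))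
            (U := Set.Iio (z 0)) (Set.Iio_subset_Iio (by linarith)) (fun s hs => hs.2)
            (Set.disjoint_left.2 fun s hs hs' => not_lt.2 hs'.1 hs)
          omega
      · left
        push Not at hJ
        -- A zero element supplies four points. Entering it from a nonzero value costs two breaks,
        -- hence `4k + 1 + 2 + 4 = 4(k + 1) + 3`.
        have h4 := hzero k (by omega) fun t ht => apply_eq_zero_of_peanoKernel hJ ht
        have hJ' := hcl k hJ
        refine ⟨⟨knot a b n k, hlt, hJ'⟩, ?_⟩
        have hadd : ∀ x ≤ knot a b n k, pointCount X Y (Set.Iio x) + 4 ≤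
            pointCount X Y (Set.Iio (knot a b n (k + 1))) := by
          intro x hx
          refine le_trans (Nat.add_le_add_left h4 _) (pointCount_add_le X Y ?_ ?_ ?_)
          · exact Set.Iio_subset_Iio (by linarith)
          · exact fun s hs => hs.2
          · exact Set.disjoint_left.2 fun s hs hs' => by
              have := hs'.1; have : s < x := hs; linarith
        rcases ih (by omega) with ⟨-, hc, hc'⟩ | ⟨z, y, hzy, hyk, hKz, hKy, hc⟩
        · have h5 := hadd _ le_rfl
          refine ⟨by omega, fun ⟨t, ht, hne⟩ => ?_⟩
          have htk : t < knot a b n k := by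
            by_contra h
            exact hne (hJ' t ⟨not_lt.1 h, ht.le⟩)
          have := hc' ⟨t, htk, hne⟩
          omega
        · obtain ⟨τ, hτ, σ, hσ, h1, h2, h3⟩ := exists_two_breakpoints_left hzy hyk hlt hJ' hKz hKy
          have h5 : 4 * k + 1 + 2 ≤ pointCount X Y (Set.Iic (knot a b n k)) := by
            refine le_trans ?_ (pointCount_add_le X Y (S := Set.Iio z)
              (T := Set.Ioc z (knot a b n k)) ?_ ?_ ?_)
            · exact add_le_add hc (two_le_pointCount (hXY hτ) (hXY hσ) ⟨h1, by linarith⟩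
                ⟨by linarith, h3⟩ h2.ne)
            · intro s hs
              have : s < z := hs
              exact (by linarith : s ≤ knot a b n k)
            · exact fun s hs => hs.2
            · exact Set.disjoint_left.2 fun s hs hs' => by
                have := hs'.1; have : s < z := hs; linarith
          have h6 := pointCount_add_le X Y (S := Set.Iic (knot a b n k))
            (T := Set.Ioo (knot a b n k) (knot a b n (k + 1))) (U := Set.Iio (knot a b n (k + 1)))
            (fun s hs => lt_of_le_of_lt hs hlt) (fun s hs => hs.2)
            (Set.disjoint_left.2 fun s hs hs' => not_lt.2 hs hs'.1)
          exact ⟨by omega, fun _ => by omega⟩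
  have hK : ∀ s, peanoKernel D 1 s = 0 := by
    have h := main n le_rfl
    rw [knot_self a b hn] at h
    rcases h with ⟨-, -, hc⟩ | ⟨z, y, hzy, hyb, hKz, hKy, hc⟩
    · intro s
      rcases lt_or_ge s b with hs | hs
      · by_contra hne
        have h1 := hc ⟨s, hs, hne⟩
        have h2 := pointCount_le X Y (Set.Iio b)
        omega
      · exact hright s hs
    -- The kernel must return to zero at `b`: two more breaks give `4n + 3` points.
    · exfalso
      obtain ⟨τ, hτ, σ, hσ, h1, h2, h3⟩ := exists_two_breakpoints_left hzy hyb
        (by linarith : b < b + 1) (fun s hs => hright s hs.1) hKz hKy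
      have h4 := pointCount_add_le X Y (S := Set.Iio z) (T := Set.Ioc z b) (U := Set.univ)
        (Set.subset_univ _) (Set.subset_univ _) (Set.disjoint_left.2 fun s hs hs' => by
          have := hs'.1; have : s < z := hs; linarith)
      have h5 := two_le_pointCount (S := Set.Ioc z b) (hXY hτ) (hXY hσ) ⟨h1, by linarith⟩
        ⟨by linarith, h3⟩ h2.ne
      have h6 := pointCount_le X Y Set.univ
      omega
  ext τ
  exact apply_eq_zero_of_peanoKernel (u := τ - 1) (v := τ + 1) (fun s _ => hK s)
    ⟨by linarith, by linarith⟩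

/-! ### Assembling the exact rule. -/

lemma support_smul_mapDomain {μ : ℝ →₀ ℝ} {h : ℝ} (hh : h ≠ 0) {f : ℝ → ℝ}
    (hf : Function.Injective f) : (h • μ.mapDomain f).support = μ.support.image f := by
  rw [Finsupp.support_smul_eq hh, Finsupp.mapDomain_support_of_injective hf]

lemma exists_twoPoint_rule {A B : ℝ} (h : AdmissibleState A B) :
    ∃ (A' B' : ℝ) (μ : ℝ →₀ ℝ), AdmissibleState A' B' ∧ 0 < A' ∧
      IsElementRule 0 1 A B A' B' μ ∧ μ.support.card = 2 := by
  obtain ⟨τ₁, τ₂, ω₁, ω₂, A', B', h0, h12, h1, hω₁, hω₂, hadm, hA', hex⟩ :=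
    exists_twoPoint_unit h
  have hsupp : (Finsupp.single τ₁ ω₁ + Finsupp.single τ₂ ω₂).support = {τ₁, τ₂} := by
    rw [Finsupp.support_add_eq, Finsupp.support_single _ hω₁,
      Finsupp.support_single _ hω₂]
    · rfl
    · rw [Finsupp.support_single _ hω₁, Finsupp.support_single _ hω₂]
      simpa using h12.ne
  refine ⟨A', B', Finsupp.single τ₁ ω₁ + Finsupp.single τ₂ ω₂, hadm, hA',
    isElementRule_unit ?_ fun c => ?_, ?_⟩
  · intro t ht
    rw [hsupp, Finset.mem_insert, Finset.mem_singleton] at ht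
    rcases ht with rfl | rfl <;> constructor <;> linarith
  · rw [hex c]
    simp [Finsupp.linearCombination_single]
  · rw [hsupp, Finset.card_pair h12.ne]

lemma exists_threePoint_rule {A B : ℝ} (h : AdmissibleState A B) (hA : 0 ≤ A) :
    ∃ (d : ℝ) (μ : ℝ →₀ ℝ), 0 < d ∧ IsElementRule 0 1 A B (-A) B μ ∧
      μ.support = {1 / 2 - d, 1 / 2, 1 / 2 + d} := by
  obtain ⟨d, w, w₀, hd, hd', hw, hw₀, hex⟩ := exists_threePoint_unit h hA
  have hs1 : (Finsupp.single (1 / 2) w₀ + Finsupp.single (1 / 2 + d) w).support =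
      {1 / 2, 1 / 2 + d} := by
    rw [Finsupp.support_add_eq, Finsupp.support_single _ hw₀,
      Finsupp.support_single _ hw]
    · rfl
    · rw [Finsupp.support_single _ hw, Finsupp.support_single _ hw₀]
      simpa using hd.ne'
  have hsupp : (Finsupp.single (1 / 2 - d) w +
      (Finsupp.single (1 / 2) w₀ + Finsupp.single (1 / 2 + d) w)).support =
      {1 / 2 - d, 1 / 2, 1 / 2 + d} := by
    rw [Finsupp.support_add_eq, hs1, Finsupp.support_single _ hw]
    · rfl
    · rw [hs1, Finsupp.support_single _ hw, Finset.disjoint_singleton_left,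
        Finset.mem_insert, Finset.mem_singleton]
      rintro (h | h) <;> linarith
  refine ⟨d, _, hd, isElementRule_unit ?_ fun c => ?_, hsupp⟩
  · intro t ht
    rw [hsupp, Finset.mem_insert, Finset.mem_insert, Finset.mem_singleton] at ht
    rcases ht with rfl | rfl | rfl <;> constructor <;> linarith
  · rw [hex c]
    simp only [map_add, Finsupp.linearCombination_single, smul_eq_mul]
    ring

lemma exists_rule_sequence : ∃ (A B : ℕ → ℝ) (μ : ℕ → ℝ →₀ ℝ), A 0 = 0 ∧ B 0 = 0 ∧
    (∀ k, AdmissibleState (A k) (B k)) ∧ (∀ k, 0 < A (k + 1)) ∧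
    (∀ k, IsElementRule 0 1 (A k) (B k) (A (k + 1)) (B (k + 1)) (μ k)) ∧
    ∀ k, (μ k).support.card = 2 := by
  have step : ∀ s : {p : ℝ × ℝ // AdmissibleState p.1 p.2},
      ∃ (s' : {p : ℝ × ℝ // AdmissibleState p.1 p.2}) (μ : ℝ →₀ ℝ), 0 < s'.1.1 ∧
        IsElementRule 0 1 s.1.1 s.1.2 s'.1.1 s'.1.2 μ ∧ μ.support.card = 2 := fun s => by
    obtain ⟨A', B', μ, h1, h2, h3, h4⟩ := exists_twoPoint_rule s.2
    exact ⟨⟨(A', B'), h1⟩, μ, h2, h3, h4⟩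
  choose next μ h1 h2 h3 using step
  let S : ℕ → {p : ℝ × ℝ // AdmissibleState p.1 p.2} := fun k =>
    Nat.rec ⟨(0, 0), admissibleState_zero⟩ (fun _ s => next s) k
  exact ⟨fun k => (S k).1.1, fun k => (S k).1.2, fun k => μ (S k), rfl, rfl, fun k => (S k).2,
    fun k => h1 (S k), fun k => h2 (S k), fun k => h3 (S k)⟩

lemma knot_mem_Icc {a b : ℝ} (hab : a < b) {n k : ℕ} (hn : 1 ≤ n) (hk : k ≤ n) :
    knot a b n k ∈ Set.Icc a b := by
  have h := (knot_strictMono hab hn).monotone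
  have h1 := h (Nat.zero_le k)
  have h2 := h hk
  rw [knot_zero] at h1
  rw [knot_self a b hn] at h2
  exact ⟨h1, h2⟩

lemma add_sub_knot (a b : ℝ) {n k : ℕ} (hn : 1 ≤ n) (hk : k ≤ n) :
    a + b - knot a b n k = knot a b n (n - k) := by
  have : (n : ℝ) ≠ 0 := by positivity
  simp only [knot, Nat.cast_sub hk]
  field_simp
  ring

/-- By `C¹` continuity the polynomial piece matches `f` and its derivative up to the closed element.
Boundary terms are thus the same from both sides of a knot and can telescope. -/
lemma IsC1QuinticSpline.element_exact {a b : ℝ} (hab : a < b) {n : ℕ} (hn : 1 ≤ n) {f : ℝ → ℝ}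
    (hf : IsC1QuinticSpline a b n f) {k : ℕ} (hk : k < n) {α β α' β' : ℝ} {μ : ℝ →₀ ℝ}
    (H : IsElementRule (knot a b n k) (knot a b n (k + 1)) α β α' β' μ) :
    α * f (knot a b n k) + β * derivWithin f (Set.Icc a b) (knot a b n k) +
        ∫ t in knot a b n k..knot a b n (k + 1), f t =
      Finsupp.linearCombination ℝ f μ + α' * f (knot a b n (k + 1)) +
        β' * derivWithin f (Set.Icc a b) (knot a b n (k + 1)) := by
  obtain ⟨p, hp, hfp⟩ := hf.2 (k + 1) (by omega) (by omega)
  have hlt := knot_strictMono hab hn (Nat.lt_succ_self k)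
  set l := knot a b n k with hl
  set r := knot a b n (k + 1) with hr
  have hfp : ∀ t ∈ Set.Ioo l r, f t = p.eval t := hfp
  have hsub : Set.Icc l r ⊆ Set.Icc a b :=
    Set.Icc_subset_Icc (knot_mem_Icc hab hn hk.le).1 (knot_mem_Icc hab hn hk).2
  have hcl : Set.Icc l r ⊆ closure (Set.Ioo l r) := by rw [closure_Ioo hlt.ne]
  have hval : Set.EqOn f (fun t => p.eval t) (Set.Icc l r) :=
    Set.EqOn.of_subset_closure hfp (hf.1.continuousOn.mono hsub) p.continuous.continuousOn
      Set.Ioo_subset_Icc_self hcl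
  have hder : Set.EqOn (derivWithin f (Set.Icc a b)) (fun t => p.derivative.eval t)
      (Set.Icc l r) := by
    refine Set.EqOn.of_subset_closure (s := Set.Ioo l r) ?_ ?_
      p.derivative.continuous.continuousOn Set.Ioo_subset_Icc_self hcl
    · intro t ht
      have hn1 : Set.Ioo l r ∈ nhds t := Ioo_mem_nhds ht.1 ht.2
      rw [derivWithin_of_mem_nhds
        (Filter.mem_of_superset hn1 (Set.Ioo_subset_Icc_self.trans hsub))]
      have : f =ᶠ[nhds t] fun t => p.eval t := by
        filter_upwards [hn1] with s hs using hfp s hs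
      rw [this.deriv_eq]
      simp
    · exact (hf.1.continuousOn_derivWithin (uniqueDiffOn_Icc hab) le_rfl).mono hsub
  have hli : l ∈ Set.Icc l r := ⟨le_rfl, hlt.le⟩
  have hri : r ∈ Set.Icc l r := ⟨hlt.le, le_rfl⟩
  have hint : ∫ t in l..r, f t = ∫ t in l..r, p.eval t :=
    intervalIntegral.integral_congr (by rw [Set.uIcc_of_le hlt.le]; exact hval)
  have hlc : Finsupp.linearCombination ℝ f μ =
      Finsupp.linearCombination ℝ (fun t => p.eval t) μ := by
    simp only [Finsupp.linearCombination_apply]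
    refine Finsupp.sum_congr fun t ht => ?_
    rw [hfp t (H.support_subset t ht)]
  rw [hval hli, hval hri, hder hli, hder hri, hint, hlc]
  exact H.exact p hp

/-- `δ` records the jump between the outgoing value coefficient of one element and the incoming one
of the next; it occurs only at a middle knot. -/
lemma exists_element_rules {a b : ℝ} (hab : a < b) {n : ℕ} (hn : 1 ≤ n) :
    ∃ (α β δ : ℕ → ℝ) (ν : ℕ → ℝ →₀ ℝ), α 0 = 0 ∧ β 0 = 0 ∧ α n = 0 ∧ β n = 0 ∧
      (∀ k, 2 * k = n → δ k ≠ 0) ∧ (∀ k, 2 * k ≠ n → δ k = 0) ∧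
      (∀ k < n, IsElementRule (knot a b n k) (knot a b n (k + 1)) (α k) (β k)
        (α (k + 1) + δ (k + 1)) (β (k + 1)) (ν k)) ∧
      (∀ k, n ≤ k → ν k = 0) ∧
      (∀ k < n, 2 * k + 1 ≠ n → (ν k).support.card = 2) ∧
      (∀ k < n, 2 * k + 1 = n → ∃ d : ℝ, 0 < d ∧
        (ν k).support = {(a + b) / 2 - d, (a + b) / 2, (a + b) / 2 + d}) := by
  obtain ⟨A, B, μ, hA0, hB0, hadm, hApos, hμ, hcard⟩ := exists_rule_sequence
  have hn0 : (0 : ℝ) < n := by exact_mod_cast hn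
  obtain ⟨h, hh⟩ : ∃ h, h = (b - a) / n := ⟨_, rfl⟩
  have hpos : 0 < h := by rw [hh]; exact div_pos (by linarith) hn0
  have hknot : ∀ k, knot a b n (k + 1) = knot a b n k + h := fun k => by rw [knot_succ, hh]
  have hinj : ∀ x : ℝ, Function.Injective fun t => x + h * t := fun x s t hst => by
    simpa [hpos.ne'] using hst
  have hAnn : ∀ k, 0 ≤ A k := fun k => by
    rcases k with _ | k
    · exact hA0.ge
    · exact (hApos k).le
  have hleft : ∀ k, ∃ ν : ℝ →₀ ℝ, IsElementRule (knot a b n k) (knot a b n (k + 1)) (h * A k)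
      (h ^ 2 * B k) (h * A (k + 1)) (h ^ 2 * B (k + 1)) ν ∧ ν.support.card = 2 := fun k => by
    refine ⟨_, hknot k ▸ (hμ k).scale (knot a b n k) hpos, ?_⟩
    rw [support_smul_mapDomain hpos.ne' (hinj _), Finset.card_image_of_injective _ (hinj _),
      hcard]
  -- Left of the centre this is the scaled recursion, from the centre on its mirror image. At a
  -- middle knot the mirrored branch applies, so the left element delivers `2 * h * A k` too much.
  let α : ℕ → ℝ := fun k => if 2 * k < n then h * A k else -(h * A (n - k))
  let β : ℕ → ℝ := fun k => if 2 * k < n then h ^ 2 * B k else h ^ 2 * B (n - k)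
  let δ : ℕ → ℝ := fun k => if 2 * k = n then 2 * h * A k else 0
  have key : ∀ k, ∃ ν : ℝ →₀ ℝ, (k < n → IsElementRule (knot a b n k) (knot a b n (k + 1))
      (α k) (β k) (α (k + 1) + δ (k + 1)) (β (k + 1)) ν ∧
      (2 * k + 1 ≠ n → ν.support.card = 2) ∧
      (2 * k + 1 = n → ∃ d : ℝ, 0 < d ∧
        ν.support = {(a + b) / 2 - d, (a + b) / 2, (a + b) / 2 + d})) ∧ (n ≤ k → ν = 0) := by
    intro k
    rcases Nat.lt_or_ge k n with hk | hk
    swap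
    · exact ⟨0, fun h => absurd h (by omega), fun _ => rfl⟩
    suffices ∃ ν : ℝ →₀ ℝ, IsElementRule (knot a b n k) (knot a b n (k + 1))
      (α k) (β k) (α (k + 1) + δ (k + 1)) (β (k + 1)) ν ∧
      (2 * k + 1 ≠ n → ν.support.card = 2) ∧
      (2 * k + 1 = n → ∃ d : ℝ, 0 < d ∧
        ν.support = {(a + b) / 2 - d, (a + b) / 2, (a + b) / 2 + d}) by
      obtain ⟨ν, hν⟩ := this
      exact ⟨ν, fun _ => hν, fun h => absurd h (by omega)⟩
    rcases lt_trichotomy (2 * k + 1) n with hc | hc | hc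
    · obtain ⟨ν, hν, hν2⟩ := hleft k
      refine ⟨ν, ?_, fun _ => hν2, fun h => absurd h hc.ne⟩
      have e1 : α k = h * A k := if_pos (by omega)
      have e2 : β k = h ^ 2 * B k := if_pos (by omega)
      have e3 : α (k + 1) + δ (k + 1) = h * A (k + 1) := by
        simp only [α, δ]
        rcases Nat.lt_or_ge (2 * (k + 1)) n with h' | h'
        · rw [if_pos h', if_neg h'.ne, add_zero]
        · rw [if_neg (by omega), if_pos (by omega), show n - (k + 1) = k + 1 by omega]
          ring
      have e4 : β (k + 1) = h ^ 2 * B (k + 1) := by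
        simp only [β]
        rcases Nat.lt_or_ge (2 * (k + 1)) n with h' | h'
        · rw [if_pos h']
        · rw [if_neg (by omega), show n - (k + 1) = k + 1 by omega]
      rw [e1, e2, e3, e4]
      exact hν
    · obtain ⟨d, ν, hd, hν, hν3⟩ := exists_threePoint_rule (hadm k) (hAnn k)
      have hr := hν.scale (knot a b n k) hpos
      rw [← hknot k] at hr
      have e1 : α k = h * A k := if_pos (by omega)
      have e2 : β k = h ^ 2 * B k := if_pos (by omega)
      have e3 : α (k + 1) + δ (k + 1) = h * -A k := by
        simp only [α, δ]
        rw [if_neg (by omega), if_neg (by omega), show n - (k + 1) = k by omega]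
        ring
      have e4 : β (k + 1) = h ^ 2 * B k := by
        simp only [β]
        rw [if_neg (by omega), show n - (k + 1) = k by omega]
      refine ⟨_, by rw [e1, e2, e3, e4]; exact hr, fun h => absurd hc h, fun _ =>
        ⟨h * d, by positivity, ?_⟩⟩
      have hmid : knot a b n k + h * (1 / 2) = (a + b) / 2 := by
        have hnk : (n : ℝ) = 2 * k + 1 := by exact_mod_cast hc.symm
        rw [hnk] at hh hn0
        rw [knot, hh, hnk]
        field_simp
        ring
      rw [support_smul_mapDomain hpos.ne' (hinj _), hν3, Finset.image_insert, Finset.image_insert,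
        Finset.image_singleton, ← hmid]
      congr 1
      · ring
      · congr 2
        ring
    · obtain ⟨ν, hν, hν2⟩ := hleft (n - (k + 1))
      have hr := hν.reflect (a + b)
      rw [add_sub_knot a b hn (by omega), add_sub_knot a b hn (by omega)] at hr
      have hi : n - (k + 1) + 1 = n - k := by omega
      rw [hi, show n - (n - k) = k by omega, show n - (n - (k + 1)) = k + 1 by omega] at hr
      have e1 : α k = -(h * A (n - k)) := if_neg (by omega)
      have e2 : β k = h ^ 2 * B (n - k) := if_neg (by omega)
      have e3 : α (k + 1) + δ (k + 1) = -(h * A (n - (k + 1))) := by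
        simp only [α, δ]
        rw [if_neg (by omega), if_neg (by omega), add_zero]
      have e4 : β (k + 1) = h ^ 2 * B (n - (k + 1)) := if_neg (by omega)
      refine ⟨_, by rw [e1, e2, e3, e4]; exact hr, fun _ => ?_, fun h => absurd h hc.ne'⟩
      rw [Finsupp.mapDomain_support_of_injective sub_right_injective,
        Finset.card_image_of_injective _ sub_right_injective, hν2]
  choose ν hν hν0 using key
  refine ⟨α, β, δ, ν, ?_, ?_, ?_, ?_, fun k hk => ?_, fun k hk => if_neg hk,
    fun k hk => (hν k hk).1, hν0, fun k hk => (hν k hk).2.1, fun k hk => (hν k hk).2.2⟩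
  · simp [α, hA0, show 0 < n by omega]
  · simp [β, hB0, show 0 < n by omega]
  · simp [α, hA0, show ¬ 2 * n < n by omega]
  · simp [β, hB0, show ¬ 2 * n < n by omega]
  · obtain ⟨j, rfl⟩ : ∃ j, k = j + 1 := ⟨k - 1, by omega⟩
    have := hApos j
    simp only [δ]
    rw [if_pos hk]
    positivity

theorem exists_exact_rule {a b : ℝ} (hab : a < b) {n : ℕ} (hn : 1 ≤ n) :
    ∃ μ : ℝ →₀ ℝ, (∀ t ∈ μ.support, t ∈ Set.Icc a b) ∧
      (∀ f, IsC1QuinticSpline a b n f → ∫ t in a..b, f t = Finsupp.linearCombination ℝ f μ) ∧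
      μ.support.card = 2 * n + 1 ∧
      (∀ k < n, 2 * k + 1 ≠ n →
        ((μ.support : Set ℝ) ∩ Set.Ioo (knot a b n k) (knot a b n (k + 1))).ncard = 2) ∧
      (∀ k < n, 2 * k + 1 = n → ∃ d : ℝ, 0 < d ∧
        (μ.support : Set ℝ) ∩ Set.Ioo (knot a b n k) (knot a b n (k + 1)) =
          {(a + b) / 2 - d, (a + b) / 2, (a + b) / 2 + d}) ∧
      ∀ k, 2 * k = n → knot a b n k ∈ μ.support := by
  obtain ⟨α, β, δ, ν, hα0, hβ0, hαn, hβn, hδ, hδ0, hν, hνz, hν2, hν3⟩ :=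
    exists_element_rules hab hn
  have hmono := knot_strictMono hab hn
  -- The jump becomes a point mass, assigned to the element on its left.
  let ρ : ℕ → ℝ →₀ ℝ := fun k => ν k + Finsupp.single (knot a b n (k + 1)) (δ (k + 1))
  have hνsub : ∀ k, ∀ t ∈ (ν k).support, t ∈ Set.Ioo (knot a b n k) (knot a b n (k + 1)) := by
    intro k t ht
    rcases Nat.lt_or_ge k n with hk | hk
    · exact (hν k hk).support_subset t ht
    · rw [hνz k hk] at ht
      simp at ht
  have hρsub : ∀ k, ∀ t ∈ (ρ k).support, t ∈ Set.Ioc (knot a b n k) (knot a b n (k + 1)) := by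
    intro k t ht
    rcases Finset.mem_union.1 (Finsupp.support_add ht) with h | h
    · exact Set.Ioo_subset_Ioc_self (hνsub k t h)
    · rw [Finset.mem_singleton.1 (Finsupp.support_single_subset h)]
      exact ⟨hmono (Nat.lt_succ_self k), le_rfl⟩
  have hdisj : ∀ i j, i ≠ j → Disjoint (ρ i).support (ρ j).support := by
    have h : ∀ i j, i < j → Disjoint (ρ i).support (ρ j).support := fun i j hij => by
      rw [Finset.disjoint_left]
      intro t h1 h2
      have h3 := (hρsub i t h1).2
      have h4 := (hρsub j t h2).1
      have h5 := hmono.monotone (show i + 1 ≤ j by omega)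
      linarith
    intro i j hij
    rcases lt_or_gt_of_ne hij with h' | h'
    · exact h i j h'
    · exact (h j i h').symm
  have hsupp : (∑ k ∈ Finset.range n, ρ k).support =
      (Finset.range n).biUnion fun k => (ρ k).support :=
    Finsupp.support_sum_eq_biUnion _ hdisj
  have hρeq : ∀ k, 2 * (k + 1) ≠ n → ρ k = ν k := fun k hk => by
    simp [ρ, hδ0 _ hk]
  have hρadd : ∀ k, 2 * (k + 1) = n →
      (ρ k).support = insert (knot a b n (k + 1)) (ν k).support ∧
        knot a b n (k + 1) ∉ (ν k).support := fun k hk => by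
    have hnot : knot a b n (k + 1) ∉ (ν k).support := fun h => lt_irrefl _ (hνsub k _ h).2
    refine ⟨?_, hnot⟩
    have hs := Finsupp.support_single (knot a b n (k + 1)) (hδ _ hk)
    rw [Finsupp.support_add_eq (by rw [hs]; simpa using hnot), hs, Finset.union_comm]
    rfl
  have hIoo : ∀ k < n, ((∑ k ∈ Finset.range n, ρ k).support : Set ℝ) ∩
      Set.Ioo (knot a b n k) (knot a b n (k + 1)) = (ν k).support := by
    intro k hk
    ext t
    rw [hsupp, Set.mem_inter_iff, Finset.mem_coe, Finset.mem_coe, Finset.mem_biUnion]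
    constructor
    · rintro ⟨⟨j, hj, ht⟩, h1, h2⟩
      have h3 := hρsub j t ht
      obtain rfl : j = k := by
        by_contra hne
        rcases lt_or_gt_of_ne hne with h | h
        · have := hmono.monotone (show j + 1 ≤ k by omega)
          linarith [h3.2]
        · have := hmono.monotone (show k + 1 ≤ j by omega)
          linarith [h3.1]
      by_cases hj2 : 2 * (j + 1) = n
      · rw [(hρadd j hj2).1] at ht
        exact Finset.mem_of_mem_insert_of_ne ht h2.ne
      · rwa [hρeq j hj2] at ht
    · intro ht
      refine ⟨⟨k, Finset.mem_range.2 hk, ?_⟩, hνsub k t ht⟩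
      by_cases hj2 : 2 * (k + 1) = n
      · rw [(hρadd k hj2).1]
        exact Finset.mem_insert_of_mem ht
      · rwa [hρeq k hj2]
  refine ⟨∑ k ∈ Finset.range n, ρ k, ?_, ?_, ?_, ?_, ?_, ?_⟩
  · intro t ht
    rw [hsupp, Finset.mem_biUnion] at ht
    obtain ⟨k, hk, ht⟩ := ht
    have hk := Finset.mem_range.1 hk
    have h1 := hρsub k t ht
    exact ⟨(knot_mem_Icc hab hn hk.le).1.trans h1.1.le, h1.2.trans (knot_mem_Icc hab hn hk).2⟩
  · intro f hf
    have hint : ∀ k < n, IntervalIntegrable f MeasureTheory.volume (knot a b n k)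
        (knot a b n (k + 1)) := fun k hk => by
      refine ContinuousOn.intervalIntegrable (hf.1.continuousOn.mono ?_)
      rw [Set.uIcc_of_le (hmono (Nat.lt_succ_self k)).le]
      exact Set.Icc_subset_Icc (knot_mem_Icc hab hn hk.le).1 (knot_mem_Icc hab hn hk).2
    have hsum := intervalIntegral.sum_integral_adjacent_intervals hint
    rw [knot_zero, knot_self a b hn] at hsum
    let T : ℕ → ℝ := fun k =>
      α k * f (knot a b n k) + β k * derivWithin f (Set.Icc a b) (knot a b n k)
    have htel := Finset.sum_range_sub T n
    have hT0 : T 0 = 0 := by simp [T, hα0, hβ0]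
    have hTn : T n = 0 := by simp [T, hαn, hβn]
    rw [← hsum, map_sum, ← add_zero (∑ k ∈ Finset.range n, Finsupp.linearCombination ℝ f (ρ k)),
      show (0 : ℝ) = T n - T 0 by rw [hT0, hTn, sub_zero], ← htel, ← Finset.sum_add_distrib]
    refine Finset.sum_congr rfl fun k hk => ?_
    have := hf.element_exact hab hn (Finset.mem_range.1 hk) (hν k (Finset.mem_range.1 hk))
    simp only [ρ, T, map_add, Finsupp.linearCombination_single, smul_eq_mul]
    linarith
  · rw [hsupp, Finset.card_biUnion fun i _ j _ hij => hdisj i j hij]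
    -- Index `(n - 1) / 2` is the middle element for odd `n` and the one ending at the midpoint for
    -- even `n`; it holds the extra node.
    have hc : ∀ k ∈ Finset.range n,
        (ρ k).support.card = 2 + if (n - 1) / 2 = k then 1 else 0 := by
      intro k hk
      have hk := Finset.mem_range.1 hk
      by_cases h1 : 2 * k + 1 = n
      · obtain ⟨d, hd, h3⟩ := hν3 k hk h1
        rw [hρeq k (by omega), h3, if_pos (by omega), Finset.card_eq_three.2
          ⟨_, _, _, ?_, ?_, ?_, rfl⟩] <;> linarith
      · by_cases h2 : 2 * (k + 1) = n
        · rw [(hρadd k h2).1, Finset.card_insert_of_notMem (hρadd k h2).2, hν2 k hk h1,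
            if_pos (by omega)]
        · rw [hρeq k h2, hν2 k hk h1, if_neg (by omega)]
    rw [Finset.sum_congr rfl hc, Finset.sum_add_distrib, Finset.sum_ite_eq, if_pos
      (Finset.mem_range.2 (by omega))]
    simp [mul_comm]
  · intro k hk h1
    rw [hIoo k hk, Set.ncard_coe_finset, hν2 k hk h1]
  · intro k hk h1
    obtain ⟨d, hd, h3⟩ := hν3 k hk h1
    exact ⟨d, hd, by rw [hIoo k hk, h3]; simp⟩
  · intro k hk
    obtain ⟨j, rfl⟩ : ∃ j, k = j + 1 := ⟨k - 1, by omega⟩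
    rw [hsupp, Finset.mem_biUnion]
    exact ⟨j, Finset.mem_range.2 (by omega), by
      rw [(hρadd j hk).1]; exact Finset.mem_insert_self _ _⟩

/-! ### Uniqueness and the final statement. -/

/-- The atomic functional of a quadrature rule. -/
noncomputable def QuadratureRule.functional {a b : ℝ} (Q : QuadratureRule a b) : ℝ →₀ ℝ :=
  ∑ t ∈ Q.nodes, Finsupp.single t (Q.weight t)

lemma QuadratureRule.linearCombination_functional {a b : ℝ} (Q : QuadratureRule a b) (f : ℝ → ℝ) :
    Finsupp.linearCombination ℝ f Q.functional = Q.apply f := by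
  simp [functional, QuadratureRule.apply, Finsupp.linearCombination_single]

lemma QuadratureRule.support_functional_subset {a b : ℝ} (Q : QuadratureRule a b) :
    Q.functional.support ⊆ Q.nodes := by
  intro t ht
  obtain ⟨s, hs, h⟩ := Finset.mem_biUnion.1 (Finsupp.support_finsetSum ht)
  rwa [Finset.mem_singleton.1 (Finsupp.support_single_subset h)]

theorem corollary1 (a b : ℝ) (hab : a < b) (n : ℕ) (hn : 1 ≤ n) :
    (∃ Q : QuadratureRule a b, Q.IsGaussian n) ∧
    ∀ Q : QuadratureRule a b, Q.IsGaussian n →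
      Q.nodes.card = 2 * n + 1 ∧
      (Even n →
        (∀ k : ℕ, 1 ≤ k → k ≤ n → ((Q.nodes : Set ℝ) ∩ subinterval a b n k).ncard = 2) ∧
        knot a b n (n / 2) = (a + b) / 2 ∧ (a + b) / 2 ∈ Q.nodes) ∧
      (Odd n →
        (∀ k : ℕ, 1 ≤ k → k ≤ n → k ≠ (n + 1) / 2 →
          ((Q.nodes : Set ℝ) ∩ subinterval a b n k).ncard = 2) ∧
        ∃ d : ℝ, 0 < d ∧
          (Q.nodes : Set ℝ) ∩ subinterval a b n ((n + 1) / 2) =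
            {(a + b) / 2 - d, (a + b) / 2, (a + b) / 2 + d}) := by
  obtain ⟨μ, hsub, hex, hcard, h2, h3, hmid⟩ := exists_exact_rule hab hn
  have htwo : ∀ k < n,
      2 ≤ ((μ.support : Set ℝ) ∩ Set.Ioo (knot a b n k) (knot a b n (k + 1))).ncard := by
    intro k hk
    by_cases h : 2 * k + 1 = n
    · obtain ⟨d, hd, he⟩ := h3 k hk h
      rw [he, Set.ncard_eq_three.2 ⟨_, _, _, ?_, ?_, ?_, rfl⟩]
      · norm_num
      all_goals linarith
    · exact (h2 k hk h).ge
  have huniq : ∀ Q : QuadratureRule a b, Q.IsExact n → Q.nodes.card ≤ 2 * n + 1 →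
      Q.nodes = μ.support := by
    intro Q hQ hQc
    have hD : Q.functional - μ = 0 := by
      refine eq_zero_of_annihilates hab hn (X := Q.nodes) (Y := μ.support) ?_ ?_ ?_ ?_ ?_
      · intro τ hτ
        rcases Finset.mem_union.1 (Finsupp.support_sub hτ) with h | h
        · exact Q.nodes_subset (Q.support_functional_subset h)
        · exact hsub τ h
      · intro f hf
        rw [map_sub, Q.linearCombination_functional, ← hQ f hf, ← hex f hf, sub_self]
      · exact Finsupp.support_sub.trans
          (Finset.union_subset_union_left Q.support_functional_subset)
      · omega
      -- Without atoms of the difference, both functionals agree on the element, so the nodes of `μ`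
      -- there, at least two, are nodes of `Q` and count twice.
      · intro k hk hz
        have h4 := htwo k hk
        have h5 : ((μ.support : Set ℝ) ∩ Set.Ioo (knot a b n k) (knot a b n (k + 1))).ncard ≤
            ((Q.nodes : Set ℝ) ∩ Set.Ioo (knot a b n k) (knot a b n (k + 1))).ncard := by
          refine Set.ncard_le_ncard ?_ (Q.nodes.finite_toSet.inter_of_left _)
          rintro t ⟨ht, htJ⟩
          refine ⟨Q.support_functional_subset (Finsupp.mem_support_iff.2 ?_), htJ⟩
          have h6 := hz t htJ
          rw [Finsupp.sub_apply, sub_eq_zero] at h6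
          rw [h6]
          exact Finsupp.mem_support_iff.1 ht
        rw [pointCount]
        omega
    rw [sub_eq_zero] at hD
    have hss : μ.support ⊆ Q.nodes := hD ▸ Q.support_functional_subset
    exact (Finset.eq_of_subset_of_card_le hss (by omega)).symm
  let Q₀ : QuadratureRule a b := ⟨μ.support, μ, fun t ht => hsub t ht⟩
  have hQ₀ : Q₀.IsExact n := fun f hf => by
    rw [hex f hf, Finsupp.linearCombination_apply]
    rfl
  refine ⟨⟨Q₀, hQ₀, fun Q' hQ' => ?_⟩, fun Q hQ => ?_⟩
  · change μ.support.card ≤ _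
    rcases Nat.lt_or_ge (2 * n + 1) Q'.nodes.card with h | h
    · omega
    · rw [huniq Q' hQ' h]
  · have hle := hQ.2 Q₀ hQ₀
    change _ ≤ μ.support.card at hle
    have heq := huniq Q hQ.1 (by omega)
    rw [heq]
    have hJ : ∀ k, 1 ≤ k → subinterval a b n k =
        Set.Ioo (knot a b n (k - 1)) (knot a b n (k - 1 + 1)) := fun k hk => by
      rw [subinterval, Nat.sub_add_cancel hk]
    refine ⟨hcard, fun hev => ?_, fun hodd => ?_⟩
    · obtain ⟨m, hm⟩ := hev
      have hmm : knot a b n (n / 2) = (a + b) / 2 := by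
        have h := add_sub_knot a b hn (Nat.div_le_self n 2)
        rw [show n - n / 2 = n / 2 by omega] at h
        linarith
      refine ⟨fun k hk hkn => ?_, hmm, ?_⟩
      · rw [hJ k hk]
        exact h2 (k - 1) (by omega) (by omega)
      · rw [← hmm]
        exact hmid (n / 2) (by omega)
    · obtain ⟨m, hm⟩ := hodd
      refine ⟨fun k hk hkn hne => ?_, ?_⟩
      · rw [hJ k hk]
        exact h2 (k - 1) (by omega) (by omega)
      · rw [hJ _ (by omega)]
        exact h3 ((n + 1) / 2 - 1) (by omega) (by omega)
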